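/- Let $a,b>0$, let $N\ge 1$ be an integer, and let $w(x)=(1-x)^a(1+x)^b$ for $x\in[-1,1]$. Let $f\in C^1[-1,1]$ be real- or complex-valued with $f(-1)=f(1)=0$, and put $$G_N^{(4)}(f)=\frac{\int_{[-1,1]^N}\prod_{1\le j<k\le N}|x_j-x_k|^4\prod_{j=1}^N w(x_j)\,(1+f(x_j))\,dx_j}{\int_{[-1,1]^N}\prod_{1\le j<k\le N}|x_j-x_k|^4\prod_{j=1}^N w(x_j)\,dx_j}.$$ Let $P_j^{(a-1,b-1)}$, $j\ge 0$, be the (standard) Jacobi polynomials, let $h_j^{(a-1,b-1)}=\int_{-1}^1 P_j^{(a-1,b-1)}(x)^2(1-x)^{a-1}(1+x)^{b-1}dx$, and let $$\varphi_j^{(4)}(x)=\frac{P_j^{(a-1,b-1)}(x)}{\sqrt{h_j^{(a-1,b-1)}}}(1-x)^{\frac a2-1}(1+x)^{\frac b2-1}.$$ Let $S_N^{(4)}$ and $\varepsilon$ be the integral operators on $[-1,1]$ with kernels $$S_N^{(4)}(x,y)=\sum_{j=0}^{2N}(1-x^2)\varphi_j^{(4)}(x)\varphi_j^{(4)}(y),\qquad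 \varepsilon(x,y)=\tfrac12\,\mathrm{sgn}(x-y),$$ and let $$C_{2N}^{(4)}=\sqrt{\frac{(2N+1)(2N+a)(2N+b)(2N+a+b-1)}{(4N+a+b+1)(4N+a+b-1)}}.$$ Let $T_{\mathrm{JSE}}$ be the integral operator on $[-1,1]$ $$T_{\mathrm{JSE}}=S_N^{(4)}f-\tfrac12 S_N^{(4)}\varepsilon f'+C_{2N}^{(4)}\big(\varepsilon\varphi_{2N+1}^{(4)}\big)\otimes\varphi_{2N}^{(4)}f+\tfrac12 C_{2N}^{(4)}\big(\varepsilon\varphi_{2N+1}^{(4)}\big)\otimes\big(\varepsilon\varphi_{2N}^{(4)}\big)f',$$ where $f$ and $f'$ act as multiplication operators and $u\otimes v$ is the operator with kernel $u(x)v(y)$; that is, $T_{\mathrm{JSE}}$ has kernel $$T(x,y)=S_N^{(4)}(x,y)f(y)-\tfrac12\Big(\int_{-1}^1S_N^{(4)}(x,z)\varepsilon(z,y)\,dz\Big)f'(y)+C_{2N}^{(4)}\,\varepsilon\varphi_{2N+1}^{(4)}(x)\,\varphi_{2N}^{(4)}(y)f(y)+\tfrac12C_{2N}^{(4)}\,\varepsilon\varphi_{2N+1}^{(4)}(x)\,\varepsilon\varphi_{2N}^{(4)}(y)f'(y).$$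 Then the Fredholm determinant $$\det(I+T_{\mathrm{JSE}})=\sum_{n=0}^\infty\frac1{n!}\int_{[-1,1]^n}\det\big(T(x_i,x_j)\big)_{i,j=1}^n\,dx_1\cdots dx_n$$ is well defined (all the integrals and the series converge absolutely), and $$\big[G_N^{(4)}(f)\big]^2=\det(I+T_{\mathrm{JSE}}).$$ -/

import Mathlib

open MeasureTheory Set
open scoped Nat

noncomputable section

namespace JacobiSymplectic

/-- The Jacobi polynomial `P_n^{(α,β)}` in its standard normalization
`P_n^{(α,β)}(1) = (α+1)_n / n!`, by the explicit (hypergeometric) formula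
`P_n^{(α,β)}(x) = (1/n!) ∑_ν (n choose ν) (n+α+β+1)_ν (α+ν+1)_{n-ν} ((x-1)/2)^ν`. -/
def jacobiP (α β : ℝ) (n : ℕ) : Polynomial ℝ :=
  Polynomial.C ((n ! : ℝ)⁻¹) * ∑ ν ∈ Finset.range (n + 1),
    Polynomial.C ((n.choose ν : ℝ) * (ascPochhammer ℝ ν).eval ((n : ℝ) + α + β + 1) *
      (ascPochhammer ℝ (n - ν)).eval (α + (ν : ℝ) + 1)) *
    (Polynomial.C (1 / 2 : ℝ) * (Polynomial.X - 1)) ^ ν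

/-- The Jacobi weight `(1-x)^α (1+x)^β`. -/
def jacobiWeight (α β x : ℝ) : ℝ := (1 - x) ^ α * (1 + x) ^ β

/-- `h_n^{(α,β)} = ∫_{-1}^{1} P_n^{(α,β)}(x)² (1-x)^α (1+x)^β dx`. -/
def jacobiNormSq (α β : ℝ) (n : ℕ) : ℝ :=
  ∫ x in (-1 : ℝ)..1, (jacobiP α β n).eval x ^ 2 * jacobiWeight α β x

/-- `φ_j^{(4)}(x) = P_j^{(a-1,b-1)}(x) / √h_j^{(a-1,b-1)} · (1-x)^{a/2-1} (1+x)^{b/2-1}`. -/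
def phi4 (a b : ℝ) (j : ℕ) (x : ℝ) : ℝ :=
  (jacobiP (a - 1) (b - 1) j).eval x / √(jacobiNormSq (a - 1) (b - 1) j) *
    ((1 - x) ^ (a / 2 - 1) * (1 + x) ^ (b / 2 - 1))

/-- The kernel `ε(x,y) = sgn(x-y)/2`. -/
def epsKernel (x y : ℝ) : ℝ := 1 / 2 * Real.sign (x - y)

/-- The operator `ε` on functions on `[-1,1]`: `(εg)(x) = ∫_{-1}^{1} ε(x,y) g(y) dy`. -/
def eps (g : ℝ → ℝ) (x : ℝ) : ℝ := ∫ y in (-1 : ℝ)..1, epsKernel x y * g y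

/-- The kernel `∫_{-1}^{1} A(x,z) B(z,y) dz` of the product of two integral operators on
`[-1,1]`. -/
def kernelComp (A B : ℝ → ℝ → ℝ) (x y : ℝ) : ℝ := ∫ z in (-1 : ℝ)..1, A x z * B z y

/-- `S_N^{(4)}(x,y) = ∑_{j=0}^{2N} (1-x²) φ_j^{(4)}(x) φ_j^{(4)}(y)`. -/
def kernelS4 (a b : ℝ) (N : ℕ) (x y : ℝ) : ℝ :=
  ∑ j ∈ Finset.range (2 * N + 1), (1 - x ^ 2) * phi4 a b j x * phi4 a b j y

/-- `C_{2N}^{(4)}`. -/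
def constC4 (a b : ℝ) (N : ℕ) : ℝ :=
  √(((2 * N + 1) * (2 * N + a) * (2 * N + b) * (2 * N + a + b - 1)) /
    ((4 * N + a + b + 1) * (4 * N + a + b - 1)))

variable {𝕜 : Type*} [RCLike 𝕜]

/-- The kernel of the operator
`T_JSE = S f - (1/2) S ε f' + C (εφ_{2N+1}) ⊗ φ_{2N} f + (1/2) C (εφ_{2N+1}) ⊗ (εφ_{2N}) f'`,
where `S = S_N^{(4)}`, `C = C_{2N}^{(4)}`, `u ⊗ v` has kernel `u(x) v(y)`, and `f`, `f'` stand for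
multiplication operators; `f'` is the derivative of `f` on `[-1,1]` (one-sided at `±1`). -/
def kernelTJSE (a b : ℝ) (N : ℕ) (f : ℝ → 𝕜) (x y : ℝ) : 𝕜 :=
  (kernelS4 a b N x y : 𝕜) * f y
  - 1 / 2 * (kernelComp (kernelS4 a b N) epsKernel x y : 𝕜) * derivWithin f (Icc (-1) 1) y
  + (constC4 a b N : 𝕜) * (eps (phi4 a b (2 * N + 1)) x : 𝕜) * (phi4 a b (2 * N) y : 𝕜) * f y
  + 1 / 2 * (constC4 a b N : 𝕜) * (eps (phi4 a b (2 * N + 1)) x : 𝕜)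
      * (eps (phi4 a b (2 * N)) y : 𝕜) * derivWithin f (Icc (-1) 1) y

/-- `∏_{j<k} |x_j - x_k|^β ∏_j w(x_j)`, the unnormalized joint density of the eigenvalues. -/
def jointWeight (β : ℕ) (w : ℝ → ℝ) {N : ℕ} (x : Fin N → ℝ) : ℝ :=
  (∏ j : Fin N, ∏ k ∈ Finset.Ioi j, |x j - x k| ^ β) * ∏ j : Fin N, w (x j)

/-- `G_N^{(β)}(f)`: the expectation of `∏_j (1 + f(x_j))` under the joint eigenvalue density
on `[-1,1]^N` with Dyson index `β` and weight `w`. -/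
def mgf (β : ℕ) (w : ℝ → ℝ) (N : ℕ) (f : ℝ → 𝕜) : 𝕜 :=
  (∫ x in univ.pi (fun _ : Fin N => Icc (-1 : ℝ) 1),
      (jointWeight β w x : 𝕜) * ∏ j : Fin N, (1 + f (x j))) /
    ((∫ x in univ.pi (fun _ : Fin N => Icc (-1 : ℝ) 1), jointWeight β w x : ℝ) : 𝕜)

/-- The function `(x_1, …, x_n) ↦ det (K(x_i, x_j))_{i,j}`. -/
def fredholmMinor (K : ℝ → ℝ → 𝕜) (n : ℕ) (x : Fin n → ℝ) : 𝕜 :=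
  (Matrix.of fun i j : Fin n => K (x i) (x j)).det

/-- The `n`-th term `(1/n!) ∫_{s^n} det (K(x_i, x_j)) dx_1 ⋯ dx_n` of Fredholm's series for
`det(I + K)`, where `K` is the integral operator on the set `s` with kernel `K(x,y)`. -/
def fredholmTerm (s : Set ℝ) (K : ℝ → ℝ → 𝕜) (n : ℕ) : 𝕜 :=
  ((n ! : ℕ) : 𝕜)⁻¹ * ∫ x in univ.pi (fun _ : Fin n => s), fredholmMinor K n x

/-- Fredholm's series for `det(I + K)` on `s` is well defined: all the integrals exist and the
series converges absolutely. -/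
def FredholmDetExists (s : Set ℝ) (K : ℝ → ℝ → 𝕜) : Prop :=
  (∀ n : ℕ, IntegrableOn (fredholmMinor K n) (univ.pi (fun _ : Fin n => s))) ∧
    Summable (fun n : ℕ => ‖fredholmTerm s K n‖)

/-- The Fredholm determinant `det(I + K)` of the integral operator on `s` with kernel `K(x,y)`. -/
def fredholmDet (s : Set ℝ) (K : ℝ → ℝ → 𝕜) : 𝕜 := ∑' n : ℕ, fredholmTerm s K n

end JacobiSymplectic

end

/-! Let p_k be the orthonormal polynomials for the weight (1-x)^(a-1)(1+x)^(b-1), φ_k = p_k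
(1-x)^(a/2-1)(1+x)^(b/2-1) and u_k = (1-x²)φ_k. Then ∫ u_j φ_k = δ_jk and u_j' = ∑_k D_jk φ_k, where
D (`derivMatrix`) is antisymmetric and tridiagonal. Each u_j vanishes at ±1, so applying ε gives u_j
= ∑_k D_jk εφ_k.

The fourth power of the Vandermonde product is a confluent Vandermonde determinant, so de Bruijn's
formula (`integral_vandermonde_pow_four`) turns numerator and denominator of G into Pfaffian-type
sums (`pairSum`) of A_f = (∫ p_k p_l' w(1+f)), k, l < 2N. The square of such a sum is a fixed
multiple of det(A_f - A_fᵀ) (`exists_pairSum_sq_eq`), so G² is the quotient of this determinant by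
its value at f = 0. Moreover A_f - A_fᵀ = -2D + ∫ (u_k u_l' - u_k' u_l) f, with D cut to size 2N
(`gramMatrix_sub_transpose`).

On the operator side put v_k = φ_k f + ½ (εφ_k) f'. The kernel is ∑_{j≤2N} u_j ⊗ v_j + C εφ_{2N+1} ⊗
v_{2N}. Since C = -D_{2N,2N+1} (`derivMatrix_two_mul`), u_{2N} + C εφ_{2N+1} is a combination ∑ α_k
u_k over k < 2N (`exists_coeff_uFun_two_mul`). The rank is thus at most 2N, and the Fredholm
determinant equals det(1 + R) with R_kl = ∫ (v_k + α_k v_{2N}) u_l (`fredholmDet_finiteRank`).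

It remains to see that -2D(1 + R) = A_f - A_fᵀ. Because Dα is column 2N of the untruncated matrix,
(DR)_ml = ∑_{j≤2N} D_mj ∫ v_j u_l. Removing f' by parts and summing with u_m' = ∑ D_mj φ_j and u_m =
∑ D_mj εφ_j yields -½ ∫ (u_m u_l' - u_m' u_l) f (`sum_derivMatrix_mul_integral`). -/

noncomputable section

namespace JacobiSymplectic

variable {𝕜 : Type*} [RCLike 𝕜]

/-! ### Pfaffian-type sums and their squares. -/

section PairSum

open Equiv Matrix

variable {K : Type*} [Field K] {N : ℕ}

/-- `∑_σ sgn σ ∏_i A_{σ(i,0), σ(i,1)}`; for antisymmetric `A` it is `2^N N!` times the Pfaffian. -/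
def pairSum (A : Matrix (Fin N × Fin 2) (Fin N × Fin 2) K) : K :=
  ∑ σ : Perm (Fin N × Fin 2), (Perm.sign σ : ℤ) * ∏ i, A (σ (i, 0)) (σ (i, 1))

theorem sum_mul_det_submatrix {ι : Type*} [Fintype ι] [DecidableEq ι] (g : (ι → ι) → K)
    (B : Matrix ι ι K) :
    ∑ κ : ι → ι, g κ * (B.submatrix id κ).det =
      B.det * ∑ τ : Perm ι, (Perm.sign τ : ℤ) * g τ := by
  classical
  have h1 : ∑ κ : ι → ι, g κ * (B.submatrix id κ).det =
      ∑ κ : ι → ι with Function.Bijective κ, g κ * (B.submatrix id κ).det := by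
    symm
    apply Finset.sum_subset (Finset.filter_subset _ _)
    intro κ _ hκ
    have hinj : ¬ Function.Injective κ := fun h =>
      hκ (Finset.mem_filter.2 ⟨Finset.mem_univ _, Finite.injective_iff_bijective.1 h⟩)
    rw [Function.Injective] at hinj
    push Not at hinj
    obtain ⟨i, j, hij, hne⟩ := hinj
    rw [det_zero_of_column_eq hne (by intro k; simp [hij]), mul_zero]
  rw [h1, Finset.mul_sum]
  refine Finset.sum_bij (fun κ h => Equiv.ofBijective κ (Finset.mem_filter.1 h).2)
    (fun _ _ => Finset.mem_univ _) (fun κ _ κ' _ h => by injection h)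
    (fun τ _ => ⟨τ, Finset.mem_filter.2 ⟨Finset.mem_univ _, τ.bijective⟩,
      Equiv.coe_fn_injective rfl⟩) ?_
  intro κ hκ
  have hd : (B.submatrix id κ).det =
      (Perm.sign (Equiv.ofBijective κ (Finset.mem_filter.1 hκ).2) : ℤ) * B.det := by
    rw [← Matrix.det_permute']
    rfl
  rw [hd]
  simp only [Equiv.coe_ofBijective]
  ring

/-- The analogue of Pf(BABᵀ) = det B · Pf A, valid for any A: expanding every entry over a pair of
indices gives a sum over all maps κ, of which only the permutations survive in det B(·, κ). -/
theorem pairSum_congruence (A B : Matrix (Fin N × Fin 2) (Fin N × Fin 2) K) :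
    pairSum (B * A * Bᵀ) = B.det * pairSum A := by
  classical
  unfold pairSum
  have key : ∀ σ : Perm (Fin N × Fin 2), ∏ i, (B * A * Bᵀ) (σ (i, 0)) (σ (i, 1)) =
      ∑ κ : Fin N × Fin 2 → Fin N × Fin 2,
        (∏ i, A (κ (i, 0)) (κ (i, 1))) * ∏ p, B (σ p) (κ p) := by
    intro σ
    have h1 : ∀ i : Fin N, (B * A * Bᵀ) (σ (i, 0)) (σ (i, 1)) =
        ∑ q : Fin 2 → Fin N × Fin 2, A (q 0) (q 1) * ∏ s, B (σ (i, s)) (q s) := by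
      intro i
      rw [← (piFinTwoEquiv fun _ => Fin N × Fin 2).symm.sum_comp, Fintype.sum_prod_type]
      simp only [Matrix.mul_apply, Matrix.transpose_apply, Finset.sum_mul, Fin.prod_univ_two]
      rw [Finset.sum_comm]
      refine Finset.sum_congr rfl fun k _ => Finset.sum_congr rfl fun l _ => ?_
      simp [piFinTwoEquiv]
      ring
    simp_rw [h1]
    rw [Finset.prod_univ_sum, Fintype.piFinset_univ,
      ← (Equiv.curry (Fin N) (Fin 2) (Fin N × Fin 2)).sum_comp]
    refine Finset.sum_congr rfl fun κ _ => ?_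
    rw [Finset.prod_mul_distrib, Fintype.prod_prod_type]
    rfl
  simp_rw [key]
  refine Eq.trans ?_ (sum_mul_det_submatrix
    (fun κ : Fin N × Fin 2 → Fin N × Fin 2 => ∏ i, A (κ (i, 0)) (κ (i, 1))) B)
  simp_rw [Finset.mul_sum]
  rw [Finset.sum_comm]
  refine Finset.sum_congr rfl fun κ _ => ?_
  rw [Matrix.det_apply', Finset.mul_sum]
  refine Finset.sum_congr rfl fun σ _ => ?_
  simp only [Matrix.submatrix_apply, id]
  ring

/-- Each transposition inside a pair changes the sign of σ together with the sign of the entry of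
Aᵀ, so all 2^N terms of the expanded product give the same sum after reindexing σ. -/
theorem pairSum_sub_transpose (A : Matrix (Fin N × Fin 2) (Fin N × Fin 2) K) :
    pairSum (A - Aᵀ) = 2 ^ N * pairSum A := by
  classical
  unfold pairSum
  have key : ∀ σ : Perm (Fin N × Fin 2), ∏ i, (A - Aᵀ) (σ (i, 0)) (σ (i, 1)) =
      ∑ h : Fin N → Perm (Fin 2), ((∏ i, (Perm.sign (h i) : ℤ) : ℤ) : K) *
        ∏ i, A (σ (i, h i 0)) (σ (i, h i 1)) := by
    intro σ
    have h1 : ∀ i : Fin N, (A - Aᵀ) (σ (i, 0)) (σ (i, 1)) =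
        ∑ τ : Perm (Fin 2), ((Perm.sign τ : ℤ) : K) * A (σ (i, τ 0)) (σ (i, τ 1)) := by
      intro i
      have hu : (Finset.univ : Finset (Perm (Fin 2))) = {1, Equiv.swap 0 1} := by decide
      rw [hu, Finset.sum_pair (by decide)]
      simp [sub_eq_add_neg]
    simp_rw [h1]
    rw [Finset.prod_univ_sum, Fintype.piFinset_univ]
    refine Finset.sum_congr rfl fun h _ => ?_
    rw [Finset.prod_mul_distrib]
    push_cast
    rfl
  simp_rw [key, Finset.mul_sum]
  rw [Finset.sum_comm]
  have hconst : ∀ h : Fin N → Perm (Fin 2),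
      ∑ σ : Perm (Fin N × Fin 2), ((Perm.sign σ : ℤ) : K) *
        (((∏ i, (Perm.sign (h i) : ℤ) : ℤ) : K) * ∏ i, A (σ (i, h i 0)) (σ (i, h i 1))) =
      ∑ σ : Perm (Fin N × Fin 2), ((Perm.sign σ : ℤ) : K) * ∏ i, A (σ (i, 0)) (σ (i, 1)) := by
    intro h
    refine Fintype.sum_equiv (Equiv.mulRight (Equiv.prodCongrRight h)) _ _ fun σ => ?_
    have hs : ((Perm.sign (σ * prodCongrRight h) : ℤˣ) : ℤ) =
        (Perm.sign σ : ℤ) * ∏ i, (Perm.sign (h i) : ℤ) := by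
      rw [Perm.sign_mul, Perm.sign_prodCongrRight]
      push_cast
      rfl
    simp only [Equiv.coe_mulRight, hs, Perm.mul_apply, prodCongrRight_apply]
    push_cast
    ring
  simp_rw [hconst]
  rw [Finset.sum_const, Finset.card_univ, Fintype.card_fun, Fintype.card_perm]
  simp [Finset.mul_sum]

/-- The Gram matrix of a symplectic basis. -/
def symplecticGram (K : Type*) [Field K] (N : ℕ) : Matrix (Fin N × Fin 2) (Fin N × Fin 2) K :=
  Matrix.of fun p q => if p.1 = q.1 then (!![0, 1; -1, 0] : Matrix (Fin 2) (Fin 2) K) p.2 q.2 else 0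

/-- Induction by splitting off a hyperbolic pair e, f with B(e, f) = 1 and passing to its orthogonal
complement, the kernel of (B e, B f). -/
theorem exists_symplectic_family (N : ℕ) : ∀ (V : Type*) [AddCommGroup V] [Module K V]
    [FiniteDimensional K V] (B : V →ₗ[K] V →ₗ[K] K), (∀ x, B x x = 0) →
    (∀ x, (∀ y, B x y = 0) → x = 0) → Module.finrank K V = N * 2 →
    ∃ b : Fin N × Fin 2 → V, ∀ p q, B (b p) (b q) = symplecticGram K N p q := by
  induction N with
  | zero => exact fun V _ _ _ B _ _ _ => ⟨fun p => p.1.elim0, fun p => p.1.elim0⟩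
  | succ N ih =>
    intro V _ _ _ B halt hnd hrank
    have hneg : ∀ x y, B x y = -B y x := by
      intro x y
      have h := halt (x + y)
      simp only [map_add, LinearMap.add_apply, halt, zero_add, add_zero] at h
      linear_combination h
    have : Nontrivial V := Module.nontrivial_of_finrank_pos (R := K) (by omega)
    obtain ⟨e, he⟩ := exists_ne (0 : V)
    obtain ⟨f', hf'⟩ : ∃ y, B e y ≠ 0 := by
      by_contra! h
      exact he (hnd e h)
    set f := (B e f')⁻¹ • f' with hf
    have hef : B e f = 1 := by simp [hf, hf']
    have hfe : B f e = -1 := by rw [hneg, hef]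
    let g : V →ₗ[K] K × K := (B e).prod (B f)
    have hsurj : Function.Surjective g := by
      rintro ⟨s, t⟩
      refine ⟨s • f - t • e, ?_⟩
      simp [g, halt, hef, hfe]
    have hW : Module.finrank K (LinearMap.ker g) = N * 2 := by
      have h := LinearMap.finrank_range_add_finrank_ker g
      rw [LinearMap.range_eq_top.2 hsurj, finrank_top, Module.finrank_prod, Module.finrank_self,
        hrank] at h
      omega
    have hmem : ∀ x, x ∈ LinearMap.ker g ↔ B e x = 0 ∧ B f x = 0 := by
      intro x
      simp [g, LinearMap.mem_ker]
    obtain ⟨b, hb⟩ := ih (LinearMap.ker g)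
      (B.domRestrict₁₂ (LinearMap.ker g) (LinearMap.ker g)) (fun x => halt x)
      (by
        rintro ⟨x, hx⟩ hxy
        have hx' := (hmem x).1 hx
        refine Subtype.ext (hnd x fun v => ?_)
        -- This is the projection of an arbitrary v to the complement of e, f; it shows that the
        -- restricted form is still nondegenerate.
        have h := hxy ⟨v + B f v • e - B e v • f, (hmem _).2 ⟨?_, ?_⟩⟩
        · simp only [LinearMap.domRestrict₁₂_apply, map_add, map_sub, map_smul, smul_eq_mul] at h
          rw [hneg x e, hneg x f, hx'.1, hx'.2] at h
          simpa using h
        · simp [halt, hef]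
        · simp [halt, hfe]) hW
    refine ⟨fun p => Fin.cases (![e, f] p.2) (fun j => (b (j, p.2) : V)) p.1, ?_⟩
    have hb' : ∀ p, B e (b p) = 0 ∧ B f (b p) = 0 := fun p => (hmem _).1 (b p).2
    rintro ⟨i, s⟩ ⟨j, t⟩
    refine Fin.cases ?_ (fun i' => ?_) i <;> refine Fin.cases ?_ (fun j' => ?_) j
    · fin_cases s <;> fin_cases t <;> simp [symplecticGram, halt, hef, hfe]
    · have := hb' (j', t)
      fin_cases s <;> simp [symplecticGram, this, (Fin.succ_ne_zero _).symm]
    · have := hb' (i', s)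
      fin_cases t <;> simp [symplecticGram, hneg _ e, hneg _ f, this, Fin.succ_ne_zero]
    · have := hb (i', s) (j', t)
      rw [LinearMap.domRestrict₁₂_apply] at this
      simpa [symplecticGram] using this

theorem exists_congruence_symplecticGram [NeZero (2 : K)]
    (M : Matrix (Fin N × Fin 2) (Fin N × Fin 2) K)
    (hM : Mᵀ = -M) (hdet : M.det ≠ 0) :
    ∃ B : Matrix (Fin N × Fin 2) (Fin N × Fin 2) K, M = B * symplecticGram K N * Bᵀ := by
  classical
  obtain ⟨b, hb⟩ := exists_symplectic_family N (Fin N × Fin 2 → K) (Matrix.toLinearMap₂' K M)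
    (by
      intro x
      rw [Matrix.toLinearMap₂'_apply']
      have h : x ⬝ᵥ M *ᵥ x = -(x ⬝ᵥ M *ᵥ x) := by
        conv_lhs => rw [Matrix.dotProduct_mulVec, dotProduct_comm, ← Matrix.mulVec_transpose, hM,
          Matrix.neg_mulVec, dotProduct_neg]
      have h2 : (2 : K) * (x ⬝ᵥ M *ᵥ x) = 0 := by linear_combination h
      exact (mul_eq_zero.1 h2).resolve_left (NeZero.ne _))
    (by
      intro x hx
      have h0 : x ᵥ* M = 0 := by
        ext j
        have := hx (Pi.single j 1)
        rw [Matrix.toLinearMap₂'_apply', Matrix.dotProduct_mulVec] at this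
        simpa using this
      exact Matrix.eq_zero_of_vecMul_eq_zero hdet h0)
    (by simp)
  have hC : Matrix.of b * M * (Matrix.of b)ᵀ = symplecticGram K N := by
    ext p q
    rw [← hb, Matrix.toLinearMap₂'_apply', Matrix.dotProduct_mulVec]
    rfl
  have hJ : (symplecticGram K N) * (-symplecticGram K N) = 1 := by
    ext ⟨i, s⟩ ⟨j, t⟩
    rw [Matrix.mul_apply, Fintype.sum_prod_type]
    simp only [symplecticGram, Matrix.of_apply, Matrix.neg_apply, Fin.sum_univ_two]
    by_cases hij : i = j
    · subst hij
      rw [Finset.sum_eq_single i (by intro k _ hk; simp [hk.symm]) (by simp)]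
      fin_cases s <;> fin_cases t <;> simp
    · rw [Finset.sum_eq_zero]
      · simp [hij]
      · intro k _
        by_cases hik : i = k
        · subst hik; simp [hij]
        · simp [hik]
  have hu : IsUnit (Matrix.of b).det := by
    have := congrArg Matrix.det hJ
    rw [← hC] at this
    simp only [Matrix.det_mul, Matrix.det_one, Matrix.det_neg] at this
    refine isUnit_iff_ne_zero.2 fun h0 => ?_
    simp [h0] at this
  refine ⟨(Matrix.of b)⁻¹, ?_⟩
  rw [← hC, Matrix.transpose_nonsing_inv]
  have hu' : IsUnit (Matrix.of b)ᵀ.det := by rwa [Matrix.det_transpose]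
  rw [mul_assoc, mul_assoc, mul_assoc, Matrix.mul_nonsing_inv _ hu', mul_one,
    Matrix.nonsing_inv_mul_cancel_left _ _ hu]

/-- Putting a left null vector v into row p of the identity, with v p ≠ 0, gives a congruence that
annihilates row and column p. Every term of `pairSum` uses the index p once, so the sum vanishes. -/
theorem pairSum_eq_zero_of_det_eq_zero (M : Matrix (Fin N × Fin 2) (Fin N × Fin 2) K)
    (hM : Mᵀ = -M) (hdet : M.det = 0) : pairSum M = 0 := by
  classical
  obtain ⟨v, hv0, hv⟩ := Matrix.exists_vecMul_eq_zero_iff.2 hdet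
  obtain ⟨p, hp⟩ := Function.ne_iff.1 hv0
  set B := (1 : Matrix (Fin N × Fin 2) (Fin N × Fin 2) K).updateRow p v with hB
  have hdB : B.det = v p := by
    rw [hB, ← Matrix.det_transpose, ← Matrix.updateCol_transpose, Matrix.transpose_one,
      ← Matrix.cramer_apply, Matrix.cramer_one]
    rfl
  have hrow : ∀ q, (B * M * Bᵀ) p q = 0 := by
    intro q
    have : (B * M) p = 0 := by
      rw [Matrix.mul_apply_eq_vecMul, hB, Matrix.updateRow_self, hv]
    rw [Matrix.mul_apply_eq_vecMul, this, Matrix.zero_vecMul, Pi.zero_apply]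
  have hcol : ∀ q, (B * M * Bᵀ) q p = 0 := by
    intro q
    have h : (B * M * Bᵀ)ᵀ = -(B * M * Bᵀ) := by
      simp [Matrix.transpose_mul, hM, Matrix.mul_assoc]
    have h' := congrFun (congrFun h p) q
    rw [Matrix.transpose_apply, Matrix.neg_apply, hrow, neg_zero] at h'
    exact h'
  have h0 : pairSum (B * M * Bᵀ) = 0 := by
    unfold pairSum
    refine Finset.sum_eq_zero fun σ _ => ?_
    obtain ⟨⟨i, s⟩, hi⟩ := σ.surjective p
    rw [Finset.prod_eq_zero (Finset.mem_univ i), mul_zero]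
    fin_cases s
    · simp only [Fin.zero_eta] at hi
      rw [hi, hrow]
    · simp only [Fin.mk_one] at hi
      rw [hi, hcol]
  rw [pairSum_congruence, hdB] at h0
  exact (mul_eq_zero.1 h0).resolve_left hp

/-- All nonsingular antisymmetric matrices are congruent to one standard form, and under congruence
both sides scale by (det B)². The constant is never evaluated, because only a ratio is needed later.
-/
theorem exists_pairSum_sq_eq (K : Type*) [Field K] [NeZero (2 : K)] (N : ℕ) :
    ∃ c : K, ∀ M : Matrix (Fin N × Fin 2) (Fin N × Fin 2) K, Mᵀ = -M →
      pairSum M ^ 2 = c * M.det := by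
  refine ⟨pairSum (symplecticGram K N) ^ 2 / (symplecticGram K N).det, fun M hM => ?_⟩
  by_cases hdet : M.det = 0
  · rw [pairSum_eq_zero_of_det_eq_zero M hM hdet, hdet]
    ring
  · obtain ⟨B, hB⟩ := exists_congruence_symplecticGram M hM hdet
    rw [hB] at hdet ⊢
    rw [pairSum_congruence]
    simp only [Matrix.det_mul, Matrix.det_transpose] at hdet ⊢
    have hJ : (symplecticGram K N).det ≠ 0 := by
      intro h
      simp [h] at hdet
    field_simp

end PairSum

/-! ### Fredholm determinants of finite-rank kernels. -/

section FiniteRank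

open Equiv Matrix

/-- `det (1 + R)` is the sum of the principal minors of `R`, indexed by tuples of indices. -/
theorem sum_det_submatrix_eq_det_one_add {R : Type*} [Field R] [CharZero R] {ι : Type*} [Fintype ι]
    [DecidableEq ι] (A : Matrix ι ι R) :
    ∑ n ∈ Finset.range (Fintype.card ι + 1),
      ((n ! : ℕ) : R)⁻¹ * ∑ κ : Fin n → ι, (A.submatrix κ κ).det = (1 + A).det := by
  have hdet : (1 + A).det = ∑ s : Finset ι, (A.submatrix (Subtype.val : s → ι) Subtype.val).det := by
    rw [add_comm]
    change detRowAlternating (A.row + (1 : Matrix ι ι R).row) = _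
    rw [AlternatingMap.map_add_univ]
    exact Finset.sum_congr rfl fun s _ => det_piecewise_one_eq_submatrix_det A s
  rw [hdet, ← Finset.powerset_univ, Finset.sum_powerset, Finset.card_univ]
  refine Finset.sum_congr rfl fun n _ => ?_
  have himg : ∑ κ : Fin n → ι, (A.submatrix κ κ).det =
      ∑ κ : Fin n → ι with Function.Injective κ, (A.submatrix κ κ).det := by
    symm
    apply Finset.sum_subset (Finset.filter_subset _ _)
    intro κ _ hκ
    have hinj : ¬ Function.Injective κ := fun h => hκ (by simpa using h)
    rw [Function.Injective] at hinj
    push Not at hinj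
    obtain ⟨i, j, hij, hne⟩ := hinj
    exact det_zero_of_row_eq hne (by ext k; simp [hij])
  have hmaps : ∀ κ ∈ (Finset.univ : Finset (Fin n → ι)).filter Function.Injective,
      Finset.univ.image κ ∈ Finset.powersetCard n (Finset.univ : Finset ι) := by
    intro κ hκ
    rw [Finset.mem_powersetCard]
    refine ⟨Finset.subset_univ _, ?_⟩
    rw [Finset.card_image_of_injective _ (by simpa using hκ), Finset.card_univ, Fintype.card_fin]
  rw [himg, ← Finset.sum_fiberwise_of_maps_to hmaps, Finset.mul_sum]
  refine Finset.sum_congr rfl fun s hs => ?_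
  have hs' : s.card = n := (Finset.mem_powersetCard.1 hs).2
  have hcard : Fintype.card (Fin n) = Fintype.card s := by simp [hs']
  have key : ∀ κ ∈ ((Finset.univ : Finset (Fin n → ι)).filter Function.Injective).filter
      (fun κ => Finset.univ.image κ = s), ∃ e : Fin n ≃ s, ∀ i, (e i : ι) = κ i := by
    intro κ hκ
    have h2 := (Finset.mem_filter.1 hκ).2
    have h1 := (Finset.mem_filter.1 (Finset.mem_filter.1 hκ).1).2
    exact ⟨Equiv.ofBijective (fun i => (⟨κ i, by rw [← h2]; simp⟩ : s))
      ((Fintype.bijective_iff_injective_and_card _).2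
        ⟨fun i j hij => h1 (congrArg Subtype.val hij), hcard⟩), fun i => rfl⟩
  have : Nonempty (Fin n ≃ s) := ⟨Fintype.equivOfCardEq hcard⟩
  choose! e he using key
  have himem : ∀ e' : Fin n ≃ s, (fun i => (e' i : ι)) ∈
      ((Finset.univ : Finset (Fin n → ι)).filter Function.Injective).filter
      (fun κ => Finset.univ.image κ = s) := by
    intro e'
    simp only [Finset.mem_filter, Finset.mem_univ, true_and]
    refine ⟨Subtype.val_injective.comp e'.injective, ?_⟩
    ext x
    simp only [Finset.mem_image, Finset.mem_univ, true_and]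
    exact ⟨fun ⟨i, hi⟩ => hi ▸ (e' i).2, fun hx => ⟨e'.symm ⟨x, hx⟩, by simp⟩⟩
  rw [Finset.sum_bij' (t := (Finset.univ : Finset (Fin n ≃ s)))
    (g := fun _ => (A.submatrix (Subtype.val : s → ι) Subtype.val).det)
    (fun κ _ => e κ) (fun e' _ => fun i => (e' i : ι))]
  -- A set of n indices is listed by n! injective tuples, all with the same principal minor, which
  -- cancels the factor 1/n!.
  · rw [Finset.sum_const, Finset.card_univ, Fintype.card_equiv (Fintype.equivOfCardEq hcard),
      Fintype.card_fin, nsmul_eq_mul, inv_mul_cancel_left₀]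
    exact_mod_cast n.factorial_ne_zero
  · simp
  · exact fun e' _ => himem e'
  · intro κ hκ
    exact funext (he κ hκ)
  · intro e' he'
    ext i
    exact he _ (himem e') i
  · intro κ hκ
    rw [← Matrix.det_submatrix_equiv_self (e κ), Matrix.submatrix_submatrix]
    exact congrArg (fun v => (A.submatrix v v).det) (funext fun i => (he κ hκ i).symm)

variable {ι : Type*} [Fintype ι]

theorem fredholmMinor_finiteRank (u V : ι → ℝ → 𝕜) (n : ℕ) (x : Fin n → ℝ) :
    fredholmMinor (fun x y => ∑ k, u k x * V k y) n x =
      ∑ κ : Fin n → ι, ∑ σ : Perm (Fin n), ((Perm.sign σ : ℤ) : 𝕜) *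
        ∏ i, V (κ (σ i)) (x i) * u (κ i) (x i) := by
  unfold fredholmMinor
  rw [Matrix.det_apply', Finset.sum_comm]
  refine Finset.sum_congr rfl fun σ _ => ?_
  rw [← Finset.mul_sum]
  simp only [Matrix.of_apply]
  congr 1
  rw [Finset.prod_univ_sum, Fintype.piFinset_univ]
  symm
  -- Reindexing κ by σ collects the two factors that depend on x_i, so that the multiple integral
  -- later splits into one-dimensional ones.
  rw [← (Equiv.arrowCongr σ (Equiv.refl ι)).sum_comp]
  refine Finset.sum_congr rfl fun κ _ => ?_
  simp only [Equiv.arrowCongr_apply, Equiv.coe_refl, Function.comp_apply, id,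
    Equiv.symm_apply_apply, Finset.prod_mul_distrib]
  rw [mul_comm, ← Equiv.prod_comp σ (fun i => u (κ (σ.symm i)) (x i))]
  simp

theorem det_gram_eq_sum {ι : Type*} (R : Matrix ι ι 𝕜) (n : ℕ) (κ : Fin n → ι) :
    ∑ σ : Perm (Fin n), ((Perm.sign σ : ℤ) : 𝕜) * ∏ i, R (κ (σ i)) (κ i) =
      (R.submatrix κ κ).det := by
  rw [Matrix.det_apply']
  rfl

/-- Fredholm's determinant of a kernel of finite rank. -/
theorem fredholmDet_finiteRank [DecidableEq ι] {s : Set ℝ} (T : ℝ → ℝ → 𝕜)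
    (u V : ι → ℝ → 𝕜) (hT : ∀ x ∈ s, ∀ y ∈ s, T x y = ∑ k, u k x * V k y)
    (hs : MeasurableSet s) (hint : ∀ k l, IntegrableOn (fun x => V k x * u l x) s) :
    FredholmDetExists s T ∧
      fredholmDet s T = (1 + Matrix.of fun k l => ∫ x in s, V k x * u l x).det := by
  set R : Matrix ι ι 𝕜 := Matrix.of fun k l => ∫ x in s, V k x * u l x with hR
  have hminor : ∀ n : ℕ, EqOn (fredholmMinor T n)
      (fun x => ∑ κ : Fin n → ι, ∑ σ : Perm (Fin n), ((Perm.sign σ : ℤ) : 𝕜) *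
        ∏ i, V (κ (σ i)) (x i) * u (κ i) (x i)) (univ.pi fun _ => s) := by
    intro n x hx
    simp only
    rw [← fredholmMinor_finiteRank]
    unfold fredholmMinor
    congr 1
    ext i j
    exact hT _ (hx i trivial) _ (hx j trivial)
  have hmeas : ∀ n : ℕ, MeasurableSet (univ.pi fun _ : Fin n => s) :=
    fun n => MeasurableSet.univ_pi fun _ => hs
  have hvol : ∀ n : ℕ, (volume : Measure (Fin n → ℝ)).restrict (univ.pi fun _ => s) =
      Measure.pi fun _ => volume.restrict s := fun n => by
    rw [volume_pi, Measure.restrict_pi_pi]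
  have hprod : ∀ (n : ℕ) (κ : Fin n → ι) (σ : Perm (Fin n)), IntegrableOn
      (fun x : Fin n → ℝ => ((Perm.sign σ : ℤ) : 𝕜) * ∏ i, V (κ (σ i)) (x i) * u (κ i) (x i))
      (univ.pi fun _ => s) := by
    intro n κ σ
    rw [IntegrableOn, hvol]
    exact (Integrable.fintype_prod fun i => hint (κ (σ i)) (κ i)).const_mul _
  have hterm : ∀ n : ℕ, fredholmTerm s T n =
      ((n ! : ℕ) : 𝕜)⁻¹ * ∑ κ : Fin n → ι, (R.submatrix κ κ).det := by
    intro n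
    unfold fredholmTerm
    rw [setIntegral_congr_fun (hmeas n) (hminor n), integral_finsetSum _ fun κ _ =>
      integrable_finsetSum _ fun σ _ => hprod n κ σ]
    congr 1
    refine Finset.sum_congr rfl fun κ _ => ?_
    rw [integral_finsetSum _ fun σ _ => hprod n κ σ, ← det_gram_eq_sum]
    refine Finset.sum_congr rfl fun σ _ => ?_
    rw [integral_const_mul, hvol]
    congr 1
    rw [integral_fintype_prod_eq_prod (fun i x => V (κ (σ i)) x * u (κ i) x)]
    rfl
  -- A tuple longer than the rank repeats an index, so its minor has two equal rows and the series
  -- terminates.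
  have hzero : ∀ n ∉ Finset.range (Fintype.card ι + 1), fredholmTerm s T n = 0 := by
    intro n hn
    rw [hterm, Finset.sum_eq_zero, mul_zero]
    intro κ _
    have hinj : ¬ Function.Injective κ := fun h => by
      have := Fintype.card_le_of_injective κ h
      simp at this hn
      omega
    rw [Function.Injective] at hinj
    push Not at hinj
    obtain ⟨i, j, hij, hne⟩ := hinj
    exact det_zero_of_row_eq hne (by ext k; simp [hij])
  refine ⟨⟨fun n => ?_, ?_⟩, ?_⟩
  · exact (integrableOn_congr_fun (hminor n) (hmeas n)).2
      (integrable_finsetSum _ fun κ _ => integrable_finsetSum _ fun σ _ => hprod n κ σ)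
  · exact summable_of_ne_finset_zero (s := Finset.range (Fintype.card ι + 1))
      fun n hn => by rw [hzero n hn, norm_zero]
  · unfold fredholmDet
    rw [tsum_eq_sum hzero, ← sum_det_submatrix_eq_det_one_add]
    exact Finset.sum_congr rfl fun n _ => hterm n

end FiniteRank

/-! ### Confluent Vandermonde determinants, de Bruijn's formula and positivity of the normalization.
-/

section DeBruijn

open Polynomial Matrix Filter Topology
open scoped Kronecker

theorem det_eval_eq_prod_leadingCoeff_mul {n : ℕ} (q : ℕ → ℝ[X]) (hdeg : ∀ k, (q k).natDegree = k)
    (hq : ∀ k, q k ≠ 0) (v : Fin n → ℝ) :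
    (Matrix.of fun i j : Fin n => (q j).eval (v i)).det =
      (∏ j : Fin n, (q j).leadingCoeff) * ∏ i : Fin n, ∏ j ∈ Finset.Ioi i, (v j - v i) := by
  have hl : ∀ k, (q k).leadingCoeff ≠ 0 := fun k => leadingCoeff_ne_zero.2 (hq k)
  have h := det_eval_matrixOfPolynomials_eq_det_vandermonde v
    (fun j : Fin n => C (q j).leadingCoeff⁻¹ * q j)
    (fun j => by rw [natDegree_C_mul (inv_ne_zero (hl _)), hdeg])
    (fun j => by rw [Monic, leadingCoeff_mul, leadingCoeff_C, inv_mul_cancel₀ (hl _)])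
  rw [← det_vandermonde, h, ← Matrix.det_mul_row]
  congr 1
  ext i j
  simp [hl]

theorem finProdFinEquiv_lt_iff {N : ℕ} (i j : Fin N) (s t : Fin 2) :
    finProdFinEquiv (i, s) < finProdFinEquiv (j, t) ↔ i < j ∨ (i = j ∧ s < t) := by
  simp only [Fin.lt_def, finProdFinEquiv_apply_val, Fin.ext_iff]
  omega

theorem prod_pairs_finProdFinEquiv {N : ℕ} (g : Fin (N * 2) → Fin (N * 2) → ℝ) :
    ∏ i, ∏ j ∈ Finset.Ioi i, g i j =
      (∏ i : Fin N, g (finProdFinEquiv (i, 0)) (finProdFinEquiv (i, 1))) *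
        ∏ i : Fin N, ∏ j ∈ Finset.Ioi i, ∏ s : Fin 2, ∏ t : Fin 2,
          g (finProdFinEquiv (i, s)) (finProdFinEquiv (j, t)) := by
  have hIoi : ∀ {m : ℕ} (i : Fin m) (r : Fin m → ℝ), ∏ j ∈ Finset.Ioi i, r j =
      ∏ j, if i < j then r j else 1 := by
    intro m i r
    rw [← Finset.prod_filter]
    congr 1
    ext j
    simp
  simp_rw [hIoi]
  rw [← finProdFinEquiv.prod_comp, Fintype.prod_prod_type, ← Finset.prod_mul_distrib]
  refine Finset.prod_congr rfl fun i _ => ?_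
  have h1 : ∀ s : Fin 2, (∏ j, if finProdFinEquiv (i, s) < j then
      g (finProdFinEquiv (i, s)) j else 1) =
      (∏ j : Fin N, if i < j then ∏ t : Fin 2,
        g (finProdFinEquiv (i, s)) (finProdFinEquiv (j, t)) else 1) *
      ∏ t : Fin 2, if s < t then g (finProdFinEquiv (i, s)) (finProdFinEquiv (i, t)) else 1 := by
    intro s
    rw [← finProdFinEquiv.prod_comp, Fintype.prod_prod_type]
    have h2 : ∀ j : Fin N, (∏ t : Fin 2, if finProdFinEquiv (i, s) < finProdFinEquiv (j, t) then
        g (finProdFinEquiv (i, s)) (finProdFinEquiv (j, t)) else 1) =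
        (if i < j then ∏ t : Fin 2,
          g (finProdFinEquiv (i, s)) (finProdFinEquiv (j, t)) else 1) *
        (if i = j then ∏ t : Fin 2, if s < t then
          g (finProdFinEquiv (i, s)) (finProdFinEquiv (j, t)) else 1 else 1) := by
      intro j
      simp only [finProdFinEquiv_lt_iff]
      rcases lt_trichotomy i j with h | h | h
      · simp [h, h.ne]
      · simp [h]
      · simp [h.not_gt, h.ne']
    simp_rw [h2]
    rw [Finset.prod_mul_distrib, Finset.prod_ite_eq]
    simp
  rw [Fin.prod_univ_two, h1, h1]
  simp only [Fin.prod_univ_two, lt_self_iff_false, if_false, one_mul, mul_one, zero_lt_one,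
    if_true, show ¬ ((1 : Fin 2) < 0) by decide]
  rw [mul_right_comm, ← Finset.prod_mul_distrib, mul_comm]
  congr 1
  refine Finset.prod_congr rfl fun j _ => ?_
  split_ifs <;> simp

/-- The matrix of the values and first derivatives of the `q_k` at the points `x_i`. -/
def confluentMatrix {N : ℕ} (q : ℕ → ℝ[X]) (x : Fin N → ℝ) :
    Matrix (Fin N × Fin 2) (Fin N × Fin 2) ℝ :=
  Matrix.of fun p k => ![(q (finProdFinEquiv k : ℕ)).eval (x p.1),
    (derivative (q (finProdFinEquiv k : ℕ))).eval (x p.1)] p.2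

/-- The confluent Vandermonde determinant with double nodes. -/
theorem det_confluentMatrix {N : ℕ} (q : ℕ → ℝ[X]) (hdeg : ∀ k, (q k).natDegree = k)
    (hq : ∀ k, q k ≠ 0) (x : Fin N → ℝ) :
    (confluentMatrix q x).det = (∏ j : Fin (N * 2), (q j).leadingCoeff) *
      ∏ i : Fin N, ∏ j ∈ Finset.Ioi i, |x i - x j| ^ 4 := by
  -- Derivatives are replaced by difference quotients of step h. Multiplying by a block matrix of
  -- determinant h^N gives an ordinary Vandermonde matrix at the nodes x_i, x_i + h. Its N close
  -- pairs contribute the same h^N, which cancels before h tends to 0.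
  set M : ℝ → Matrix (Fin N × Fin 2) (Fin N × Fin 2) ℝ := fun h =>
    Matrix.of fun p k => ![(q (finProdFinEquiv k : ℕ)).eval (x p.1),
      h⁻¹ * ((q (finProdFinEquiv k : ℕ)).eval (x p.1 + h) -
        (q (finProdFinEquiv k : ℕ)).eval (x p.1))] p.2 with hM
  set P : ℝ → ℝ := fun h => (∏ j : Fin (N * 2), (q j).leadingCoeff) *
    ∏ i : Fin N, ∏ j ∈ Finset.Ioi i, ((x j - x i) ^ 2 * ((x j - x i + h) * (x j - x i - h))) with hP
  have hdet : ∀ h : ℝ, h ≠ 0 → (M h).det = P h := by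
    intro h hh
    have hfac : (((1 : Matrix (Fin N) (Fin N) ℝ) ⊗ₖ !![1, 0; 1, h]) * M h).det =
        h ^ N * (M h).det := by
      rw [Matrix.det_mul, Matrix.det_kronecker]
      simp [Matrix.det_fin_two]
    set v : Fin (N * 2) → ℝ := fun r =>
      x (finProdFinEquiv.symm r).1 + ![0, h] (finProdFinEquiv.symm r).2 with hv
    have hvv : ∀ i s, v (finProdFinEquiv (i, s)) = x i + ![0, h] s := by
      intro i s
      simp only [hv, Equiv.symm_apply_apply]
    have hval : ((1 : Matrix (Fin N) (Fin N) ℝ) ⊗ₖ !![1, 0; 1, h]) * M h =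
        (Matrix.of fun i j : Fin (N * 2) => (q j).eval (v i)).submatrix
          finProdFinEquiv finProdFinEquiv := by
      ext ⟨i, s⟩ k
      rw [Matrix.mul_apply, Fintype.sum_prod_type, Finset.sum_eq_single i
        (by intro j _ hj; simp [hj.symm]) (by simp), Matrix.submatrix_apply,
        Matrix.of_apply, hvv]
      fin_cases s
      · simp [hM]
      · simp [hM, hh]
    rw [hval, Matrix.det_submatrix_equiv_self, det_eval_eq_prod_leadingCoeff_mul q hdeg hq,
      prod_pairs_finProdFinEquiv (fun i j => v j - v i)] at hfac
    simp only [hvv, Fin.prod_univ_two, Matrix.cons_val_zero, Matrix.cons_val_one, add_zero,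
      add_sub_cancel_left, Finset.prod_const, Finset.card_univ, Fintype.card_fin] at hfac
    apply mul_left_cancel₀ (pow_ne_zero N hh)
    rw [← hfac, hP]
    simp only
    rw [mul_left_comm]
    congr 2
    refine Finset.prod_congr rfl fun i _ => Finset.prod_congr rfl fun j _ => ?_
    ring
  have hlim1 : Tendsto (fun h => (M h).det) (𝓝[≠] 0) (𝓝 (confluentMatrix q x).det) := by
    refine ((continuous_id.matrix_det).tendsto (confluentMatrix q x)).comp ?_
    refine tendsto_pi_nhds.2 fun ⟨i, s⟩ => tendsto_pi_nhds.2 fun k => ?_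
    fin_cases s
    · simp [confluentMatrix]
    · have := hasDerivAt_iff_tendsto_slope_zero.1
        ((q (finProdFinEquiv k : ℕ)).hasDerivAt (x i))
      simpa [hM, confluentMatrix] using this
  have hlim2 : Tendsto P (𝓝[≠] 0) (𝓝 (P 0)) := by
    have : Continuous P := by fun_prop
    exact this.continuousAt.mono_left nhdsWithin_le_nhds
  have heq : (confluentMatrix q x).det = P 0 :=
    tendsto_nhds_unique hlim1 (hlim2.congr' (by
      filter_upwards [self_mem_nhdsWithin] with h hh
      exact (hdet h hh).symm))
  rw [heq]
  simp only [hP]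
  congr 1
  refine Finset.prod_congr rfl fun i _ => Finset.prod_congr rfl fun j _ => ?_
  rw [show |x i - x j| ^ 4 = (x i - x j) ^ 4 from Even.pow_abs (by decide) _]
  ring

/-- De Bruijn's integration formula for the fourth power of the Vandermonde determinant. -/
theorem integral_vandermonde_pow_four {N : ℕ} (q : ℕ → ℝ[X]) (hdeg : ∀ k, (q k).natDegree = k)
    (hq : ∀ k, q k ≠ 0) {s : Set ℝ} (W : ℝ → 𝕜)
    (hint : ∀ p : ℝ[X], IntegrableOn (fun x => ((p.eval x : ℝ) : 𝕜) * W x) s) :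
    ((∏ j : Fin (N * 2), (q j).leadingCoeff : ℝ) : 𝕜) *
      ∫ x in univ.pi (fun _ : Fin N => s),
        ((∏ i : Fin N, ∏ j ∈ Finset.Ioi i, |x i - x j| ^ 4 : ℝ) : 𝕜) * ∏ i, W (x i) =
    pairSum (Matrix.of fun k l : Fin N × Fin 2 => ∫ x in s,
      (((q (finProdFinEquiv k : ℕ) * derivative (q (finProdFinEquiv l : ℕ))).eval x : ℝ) : 𝕜) * W x) := by
  have hvol : (volume : Measure (Fin N → ℝ)).restrict (univ.pi fun _ => s) =
      Measure.pi fun _ => volume.restrict s := by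
    rw [volume_pi, Measure.restrict_pi_pi]
  rw [← integral_const_mul]
  -- In the expanded determinant the variable x_i occurs only in the two rows of block i, so each
  -- permutation gives a product of functions of one variable.
  have hpt : ∀ x : Fin N → ℝ, ((∏ j : Fin (N * 2), (q j).leadingCoeff : ℝ) : 𝕜) *
      (((∏ i : Fin N, ∏ j ∈ Finset.Ioi i, |x i - x j| ^ 4 : ℝ) : 𝕜) * ∏ i, W (x i)) =
      ∑ σ : Equiv.Perm (Fin N × Fin 2), ((Equiv.Perm.sign σ : ℤ) : 𝕜) *
        ∏ i, ((((q (finProdFinEquiv (σ (i, 0)) : ℕ) *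
          derivative (q (finProdFinEquiv (σ (i, 1)) : ℕ))).eval (x i) : ℝ) : 𝕜) * W (x i)) := by
    intro x
    rw [← mul_assoc, ← RCLike.ofReal_mul, ← det_confluentMatrix q hdeg hq, ← Matrix.det_transpose,
      Matrix.det_apply', RCLike.ofReal_sum, Finset.sum_mul]
    refine Finset.sum_congr rfl fun σ _ => ?_
    rw [Finset.prod_mul_distrib, RCLike.ofReal_mul, mul_assoc, Fintype.prod_prod_type,
      RCLike.ofReal_prod]
    simp [confluentMatrix]
  simp_rw [hpt]
  have hI : ∀ σ : Equiv.Perm (Fin N × Fin 2), IntegrableOn (fun x : Fin N → ℝ =>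
      ((Equiv.Perm.sign σ : ℤ) : 𝕜) * ∏ i, ((((q (finProdFinEquiv (σ (i, 0)) : ℕ) *
          derivative (q (finProdFinEquiv (σ (i, 1)) : ℕ))).eval (x i) : ℝ) : 𝕜) * W (x i)))
      (univ.pi fun _ => s) := by
    intro σ
    rw [IntegrableOn, hvol]
    refine Integrable.const_mul ?_ _
    exact Integrable.fintype_prod (f := fun i y => (((q (finProdFinEquiv (σ (i, 0)) : ℕ) *
          derivative (q (finProdFinEquiv (σ (i, 1)) : ℕ))).eval y : ℝ) : 𝕜) * W y)
      fun i => hint _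
  rw [integral_finsetSum _ fun σ _ => hI σ]
  unfold pairSum
  refine Finset.sum_congr rfl fun σ _ => ?_
  rw [integral_const_mul, hvol]
  congr 1
  rw [integral_fintype_prod_eq_prod (fun i y => (((q (finProdFinEquiv (σ (i, 0)) : ℕ) *
          derivative (q (finProdFinEquiv (σ (i, 1)) : ℕ))).eval y : ℝ) : 𝕜) * W y)]
  rfl

theorem continuous_jacobiWeight {a b : ℝ} (ha : 0 ≤ a) (hb : 0 ≤ b) :
    Continuous (jacobiWeight a b) := by
  unfold jacobiWeight
  exact ((continuous_const.sub continuous_id).rpow_const fun _ => Or.inr ha).mul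
    ((continuous_const.add continuous_id).rpow_const fun _ => Or.inr hb)

theorem jacobiWeight_nonneg (a b : ℝ) {x : ℝ} (hx : x ∈ Icc (-1 : ℝ) 1) :
    0 ≤ jacobiWeight a b x :=
  mul_nonneg (Real.rpow_nonneg (by linarith [hx.2]) _) (Real.rpow_nonneg (by linarith [hx.1]) _)

theorem jacobiWeight_pos (a b : ℝ) {x : ℝ} (hx : x ∈ Ioo (-1 : ℝ) 1) :
    0 < jacobiWeight a b x :=
  mul_pos (Real.rpow_pos_of_pos (by linarith [hx.2]) _)
    (Real.rpow_pos_of_pos (by linarith [hx.1]) _)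

/-- The integrand is nonnegative, and it is positive on the nonempty open set of pairwise distinct
interior points. -/
theorem integral_jointWeight_pos {a b : ℝ} (ha : 0 ≤ a) (hb : 0 ≤ b) (N : ℕ) :
    0 < ∫ x in univ.pi (fun _ : Fin N => Icc (-1 : ℝ) 1), jointWeight 4 (jacobiWeight a b) x := by
  have hcont : Continuous (jointWeight 4 (jacobiWeight a b) : (Fin N → ℝ) → ℝ) := by
    have := continuous_jacobiWeight ha hb
    unfold jointWeight
    fun_prop
  have hcompact : IsCompact (univ.pi (fun _ : Fin N => Icc (-1 : ℝ) 1)) :=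
    isCompact_univ_pi fun _ => isCompact_Icc
  have hmeas : MeasurableSet (univ.pi (fun _ : Fin N => Icc (-1 : ℝ) 1)) :=
    MeasurableSet.univ_pi fun _ => measurableSet_Icc
  rw [setIntegral_pos_iff_support_of_nonneg_ae _ (hcont.continuousOn.integrableOn_compact hcompact)]
  · set O : Set (Fin N → ℝ) := (⋂ i, {x | x i ∈ Ioo (-1 : ℝ) 1}) ∩
      ⋂ i, ⋂ j ∈ Finset.Ioi i, {x | x i ≠ x j} with hO
    have hOopen : IsOpen O := by
      refine (isOpen_iInter_of_finite fun i => isOpen_Ioo.preimage (continuous_apply i)).inter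
        (isOpen_iInter_of_finite fun i => isOpen_biInter_finset fun j _ => ?_)
      exact isOpen_ne_fun (continuous_apply i) (continuous_apply j)
    have hOne : O.Nonempty := by
      refine ⟨fun i => (i : ℝ) / (N + 1), mem_iInter.2 fun i => ?_,
        mem_iInter.2 fun i => mem_iInter₂.2 fun j hj => ?_⟩
      · have hi : (i : ℝ) < N + 1 := by exact_mod_cast i.2.trans (Nat.lt_succ_self N)
        have h0 : (0 : ℝ) ≤ (i : ℝ) / (N + 1) := by positivity
        exact ⟨by linarith, (div_lt_one (by positivity)).2 hi⟩
      · have hne : (i : ℝ) ≠ j := by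
          have := (Finset.mem_Ioi.1 hj).ne
          exact_mod_cast fun h => this (Fin.ext h)
        intro h
        apply hne
        have : (N : ℝ) + 1 ≠ 0 := by positivity
        field_simp at h
        exact h
    refine (hOopen.measure_pos volume hOne).trans_le (measure_mono ?_)
    rintro x ⟨h1, h2⟩
    rw [mem_iInter] at h1 h2
    refine ⟨?_, fun i _ => Ioo_subset_Icc_self (h1 i)⟩
    refine mul_ne_zero (Finset.prod_ne_zero_iff.2 fun i _ => Finset.prod_ne_zero_iff.2 fun j hj =>
      pow_ne_zero _ (abs_ne_zero.2 (sub_ne_zero.2 ?_)))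
      (Finset.prod_ne_zero_iff.2 fun i _ => (jacobiWeight_pos a b (h1 i)).ne')
    exact mem_iInter₂.1 (h2 i) j hj
  · filter_upwards [ae_restrict_mem hmeas] with x hx
    exact mul_nonneg (Finset.prod_nonneg fun _ _ => Finset.prod_nonneg fun _ _ => by positivity)
      (Finset.prod_nonneg fun i _ => jacobiWeight_nonneg a b (hx i trivial))

end DeBruijn

/-! ### Differentiation against Jacobi weights. -/

section WeightedDerivative

open Polynomial

/-- The operator `p ↦ (1-x²) p' + (d(1-x) - c(1+x)) p`, which satisfies
`(p (1-x)^c (1+x)^d)' = (weightedDeriv c d p) (1-x)^(c-1) (1+x)^(d-1)`. -/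
def weightedDeriv (c d : ℝ) : ℝ[X] →ₗ[ℝ] ℝ[X] :=
  LinearMap.mulLeft ℝ (1 - X ^ 2 : ℝ[X]) ∘ₗ derivative +
    LinearMap.mulLeft ℝ (C d * (1 - X) - C c * (1 + X))

theorem weightedDeriv_apply (c d : ℝ) (p : ℝ[X]) : weightedDeriv c d p =
    (1 - X ^ 2) * derivative p + (C d * (1 - X) - C c * (1 + X)) * p := rfl

theorem weightedDeriv_add_mul (c d c' d' : ℝ) (p q : ℝ[X]) :
    weightedDeriv (c + c') (d + d') (p * q) = weightedDeriv c d p * q + p * weightedDeriv c' d' q := by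
  simp only [weightedDeriv_apply, derivative_mul, C_add]
  ring

theorem weightedDeriv_mul (c d : ℝ) (p q : ℝ[X]) :
    weightedDeriv c d (p * q) = weightedDeriv c d p * q + (1 - X ^ 2) * (p * derivative q) := by
  simp only [weightedDeriv_apply, derivative_mul]
  ring

theorem natDegree_weightedDeriv_le (c d : ℝ) {p : ℝ[X]} {n : ℕ} (hp : p.natDegree ≤ n) :
    (weightedDeriv c d p).natDegree ≤ n + 1 := by
  rw [weightedDeriv_apply]
  have h1 : (derivative p).natDegree ≤ n - 1 := (natDegree_derivative_le p).trans (by omega)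
  refine natDegree_add_le_of_degree_le ?_ ?_
  · rcases Nat.eq_zero_or_pos n with rfl | hn
    · rw [natDegree_eq_zero.1 (Nat.le_zero.1 hp) |>.choose_spec.symm]
      simp
    · refine natDegree_mul_le.trans ?_
      have h2 : (1 - X ^ 2 : ℝ[X]).natDegree ≤ 2 := by compute_degree
      omega
  · refine natDegree_mul_le.trans ?_
    have h2 : (C d * (1 - X) - C c * (1 + X) : ℝ[X]).natDegree ≤ 1 := by compute_degree
    omega

theorem coeff_weightedDeriv (c d : ℝ) {p : ℝ[X]} {n : ℕ} (hp : p.natDegree ≤ n) :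
    (weightedDeriv c d p).coeff (n + 1) = -(n + c + d) * p.coeff n := by
  have h0 : ∀ m, n < m → p.coeff m = 0 := fun m hm =>
    coeff_eq_zero_of_natDegree_lt (hp.trans_lt hm)
  have h : weightedDeriv c d p = derivative p - derivative p * X ^ 2 + C (d - c) * p
      - C (c + d) * (p * X) := by
    rw [weightedDeriv_apply, C_sub, C_add]
    ring
  rw [h]
  simp only [coeff_add, coeff_sub, coeff_C_mul, coeff_mul_X, coeff_derivative]
  rw [h0 (n + 1) (by omega), h0 (n + 1 + 1) (by omega)]
  rcases n with _ | n
  · simp [coeff_mul_X_pow']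
    ring
  · rw [coeff_mul_X_pow, coeff_derivative]
    push_cast
    ring

theorem jacobiWeight_eq_mul (c d : ℝ) {x : ℝ} (hx : x ∈ Ioo (-1 : ℝ) 1) :
    jacobiWeight c d x = (1 - x ^ 2) * jacobiWeight (c - 1) (d - 1) x := by
  have h1 : 0 < 1 - x := by linarith [hx.2]
  have h2 : 0 < 1 + x := by linarith [hx.1]
  unfold jacobiWeight
  rw [Real.rpow_sub_one h1.ne', Real.rpow_sub_one h2.ne']
  field_simp
  ring

theorem hasDerivAt_mul_jacobiWeight (c d : ℝ) (p : ℝ[X]) {x : ℝ} (hx : x ∈ Ioo (-1 : ℝ) 1) :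
    HasDerivAt (fun x => p.eval x * jacobiWeight c d x)
      ((weightedDeriv c d p).eval x * jacobiWeight (c - 1) (d - 1) x) x := by
  have h1 : 0 < 1 - x := by linarith [hx.2]
  have h2 : 0 < 1 + x := by linarith [hx.1]
  have h := (p.hasDerivAt x).mul
    ((((hasDerivAt_id x).const_sub 1).rpow_const (p := c) (Or.inl h1.ne')).mul
      (((hasDerivAt_id x).const_add 1).rpow_const (p := d) (Or.inl h2.ne')))
  refine (h.congr_deriv ?_)
  have e1 : (1 - x) ^ c = (1 - x) ^ (c - 1) * (1 - x) := by
    rw [Real.rpow_sub_one h1.ne']; field_simp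
  have e2 : (1 + x) ^ d = (1 + x) ^ (d - 1) * (1 + x) := by
    rw [Real.rpow_sub_one h2.ne']; field_simp
  simp only [id, Pi.mul_apply, weightedDeriv_apply, jacobiWeight, eval_add, eval_mul, eval_sub,
    eval_one, eval_pow, eval_X, eval_C, e1, e2]
  ring

theorem intervalIntegrable_jacobiWeight {c d : ℝ} (hc : -1 < c) (hd : -1 < d) :
    IntervalIntegrable (jacobiWeight c d) volume (-1) 1 := by
  have h1 : IntervalIntegrable (fun x : ℝ => (1 + x) ^ d) volume (-1) 0 := by
    have := (intervalIntegral.intervalIntegrable_rpow' (a := 0) (b := 1) hd).comp_add_left 1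
    convert this using 1 <;> norm_num
  have h2 : IntervalIntegrable (fun x : ℝ => (1 - x) ^ c) volume 0 1 := by
    have := (intervalIntegral.intervalIntegrable_rpow' (a := 1) (b := 0) hc).comp_sub_left 1
    convert this using 1 <;> norm_num
  refine IntervalIntegrable.trans (b := 0) ?_ ?_
  · refine h1.continuousOn_mul fun x hx => ?_
    rw [uIcc_of_le (by norm_num)] at hx
    exact ((continuousAt_const.sub continuousAt_id).rpow_const
      (Or.inl (by change (1 : ℝ) - x ≠ 0; exact (by linarith [hx.2] : (0 : ℝ) < 1 - x).ne'))).continuousWithinAt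
  · refine h2.mul_continuousOn fun x hx => ?_
    rw [uIcc_of_le (by norm_num)] at hx
    exact ((continuousAt_const.add continuousAt_id).rpow_const
      (Or.inl (by change (1 : ℝ) + x ≠ 0; exact (by linarith [hx.1] : (0 : ℝ) < 1 + x).ne'))).continuousWithinAt

theorem intervalIntegrable_mul_jacobiWeight {c d : ℝ} (hc : -1 < c) (hd : -1 < d) (p : ℝ[X]) :
    IntervalIntegrable (fun x => p.eval x * jacobiWeight c d x) volume (-1) 1 :=
  (intervalIntegrable_jacobiWeight hc hd).continuousOn_mul p.continuousOn

theorem jacobiWeight_one {c : ℝ} (hc : c ≠ 0) (d : ℝ) : jacobiWeight c d 1 = 0 := by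
  simp [jacobiWeight, Real.zero_rpow hc]

theorem jacobiWeight_neg_one (c : ℝ) {d : ℝ} (hd : d ≠ 0) : jacobiWeight c d (-1) = 0 := by
  simp [jacobiWeight, Real.zero_rpow hd]

theorem integral_weightedDeriv {a b : ℝ} (ha : 0 < a) (hb : 0 < b) (p : ℝ[X]) :
    ∫ x in (-1 : ℝ)..1, (weightedDeriv a b p).eval x * jacobiWeight (a - 1) (b - 1) x = 0 := by
  rw [intervalIntegral.integral_eq_sub_of_hasDerivAt_of_le (by norm_num)
    (p.continuous.mul (continuous_jacobiWeight ha.le hb.le)).continuousOn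
    (fun x hx => hasDerivAt_mul_jacobiWeight a b p hx)
    (intervalIntegrable_mul_jacobiWeight (by linarith) (by linarith) _)]
  simp [jacobiWeight_one ha.ne', jacobiWeight_neg_one _ hb.ne']

/-- Integration of polynomials against the Jacobi weight `(1-x)^(a-1) (1+x)^(b-1)`. -/
def jacobiFunctional {a b : ℝ} (ha : 0 < a) (hb : 0 < b) : ℝ[X] →ₗ[ℝ] ℝ where
  toFun p := ∫ x in (-1 : ℝ)..1, p.eval x * jacobiWeight (a - 1) (b - 1) x
  map_add' p q := by
    rw [← intervalIntegral.integral_add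
      (intervalIntegrable_mul_jacobiWeight (by linarith) (by linarith) _)
      (intervalIntegrable_mul_jacobiWeight (by linarith) (by linarith) _)]
    simp only [eval_add, add_mul]
  map_smul' r p := by
    simp [mul_assoc]

variable {a b : ℝ} (ha : 0 < a) (hb : 0 < b)

theorem jacobiFunctional_apply (p : ℝ[X]) : jacobiFunctional ha hb p =
    ∫ x in (-1 : ℝ)..1, p.eval x * jacobiWeight (a - 1) (b - 1) x := rfl

theorem jacobiFunctional_weightedDeriv (p : ℝ[X]) :
    jacobiFunctional ha hb (weightedDeriv a b p) = 0 :=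
  integral_weightedDeriv ha hb p

theorem jacobiFunctional_sq_pos {p : ℝ[X]} (hp : p ≠ 0) :
    0 < jacobiFunctional ha hb (p ^ 2) := by
  rw [jacobiFunctional_apply, intervalIntegral.integral_of_le (by norm_num),
    setIntegral_pos_iff_support_of_nonneg_ae]
  · have hsub : Ioo (-1 : ℝ) 1 \ p.roots.toFinset ⊆
        (Function.support fun x => (p ^ 2).eval x * jacobiWeight (a - 1) (b - 1) x) ∩ Ioc (-1) 1 := by
      rintro x ⟨hx, hr⟩
      refine ⟨mul_ne_zero ?_ (jacobiWeight_pos _ _ hx).ne', Ioo_subset_Ioc_self hx⟩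
      rw [eval_pow]
      refine pow_ne_zero _ fun h => hr ?_
      simpa [hp] using h
    refine lt_of_lt_of_le ?_ (measure_mono hsub)
    rw [measure_sdiff_null ((Finset.countable_toSet _).measure_zero _), Real.volume_Ioo]
    norm_num
  · filter_upwards [ae_restrict_mem measurableSet_Ioc] with x hx
    rw [eval_pow]
    exact mul_nonneg (sq_nonneg _) (jacobiWeight_nonneg _ _ (Ioc_subset_Icc_self hx))
  · exact (intervalIntegrable_iff_integrableOn_Ioc_of_le (by norm_num)).1
      (intervalIntegrable_mul_jacobiWeight (by linarith) (by linarith) _)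

end WeightedDerivative

/-! ### Jacobi polynomials: differential equation, orthogonality and the derivative matrix. -/

section JacobiPolynomials

open Polynomial

/-- The coefficient of `((x-1)/2)^ν` in `n! P_n^{(a-1,b-1)}(x)`. -/
def jacobiCoeff (a b : ℝ) (n ν : ℕ) : ℝ :=
  (n.choose ν : ℝ) * (ascPochhammer ℝ ν).eval ((n : ℝ) + a + b - 1) *
    (ascPochhammer ℝ (n - ν)).eval (a + (ν : ℝ))

theorem jacobiP_eq_sum (a b : ℝ) (n : ℕ) : jacobiP (a - 1) (b - 1) n = (n ! : ℝ)⁻¹ •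
    ∑ ν ∈ Finset.range (n + 1), jacobiCoeff a b n ν • (C (1 / 2 : ℝ) * (X - 1)) ^ ν := by
  simp only [jacobiP, smul_eq_C_mul, jacobiCoeff]
  congr 1
  refine Finset.sum_congr rfl fun ν _ => ?_
  ring_nf

theorem jacobiCoeff_succ (a b : ℝ) {n ν : ℕ} (h : ν < n) :
    ((ν : ℝ) + 1) * (ν + a) * jacobiCoeff a b n (ν + 1) =
      (n - ν) * (n + ν + a + b - 1) * jacobiCoeff a b n ν := by
  obtain ⟨m, rfl⟩ : ∃ m, n = ν + 1 + m := ⟨n - (ν + 1), by omega⟩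
  have h1 : ((ν + 1 + m).choose (ν + 1) : ℝ) * (ν + 1) = ((ν + 1 + m).choose ν : ℝ) * (m + 1) := by
    have := Nat.choose_succ_right_eq (ν + 1 + m) ν
    rw [show ν + 1 + m - ν = m + 1 by omega] at this
    exact_mod_cast this
  simp only [jacobiCoeff, show ν + 1 + m - (ν + 1) = m by omega,
    show ν + 1 + m - ν = m + 1 by omega]
  rw [ascPochhammer_succ_eval, ascPochhammer_succ_left, eval_mul, eval_comp, eval_X]
  simp only [eval_add, eval_X, eval_one]
  push_cast
  rw [show a + ((ν : ℝ) + 1) = a + ν + 1 by ring]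
  linear_combination (ν + a) * (eval ((ν : ℝ) + 1 + m + a + b - 1) (ascPochhammer ℝ ν)) *
    ((ν : ℝ) + 1 + m + a + b - 1 + ν) * eval (a + ν + 1) (ascPochhammer ℝ m) * h1

/-- In powers of t = (x-1)/2 the Jacobi operator has only two terms, so the differential equation
becomes the two-term recurrence `jacobiCoeff_succ`. -/
theorem weightedDeriv_derivative_pow_succ (a b : ℝ) (ν : ℕ) :
    weightedDeriv a b (derivative ((C (1 / 2 : ℝ) * (X - 1)) ^ (ν + 1))) =
      -(((ν : ℝ) + 1) * (ν + a)) • (C (1 / 2 : ℝ) * (X - 1)) ^ ν -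
      (((ν : ℝ) + 1) * (ν + a + b)) • (C (1 / 2 : ℝ) * (X - 1)) ^ (ν + 1) := by
  set t : ℝ[X] := C (1 / 2 : ℝ) * (X - 1) with ht
  have hd : derivative t = C (1 / 2 : ℝ) := by simp [ht]
  have hX : (X : ℝ[X]) = 1 + 2 * t := by
    have : (2 : ℝ[X]) * C (1 / 2 : ℝ) = 1 := by
      rw [show (2 : ℝ[X]) = C (2 : ℝ) from rfl, ← C_mul]
      norm_num
    rw [ht, ← mul_assoc, this]
    ring
  have hhalf : (2 : ℝ[X]) * C (1 / 2 : ℝ) = 1 := by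
    rw [show (2 : ℝ[X]) = C (2 : ℝ) from rfl, ← C_mul]
    norm_num
  have h1 : derivative (t ^ (ν + 1)) = C (((ν : ℝ) + 1) / 2) * t ^ ν := by
    rw [derivative_pow_succ, hd, show ((ν : ℝ) + 1) / 2 = ((ν : ℝ) + 1) * (1 / 2) by ring]
    simp only [C_mul, C_add, C_1, map_natCast]
    ring
  have h2 : (1 - X ^ 2) * derivative (t ^ ν) = -(2 * C (ν : ℝ)) * (t ^ ν * (1 + t)) := by
    rcases ν with _ | ν
    · simp
    · rw [derivative_pow_succ, hd, hX]
      simp only [map_natCast, C_add, C_1]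
      push_cast
      linear_combination (-2 : ℝ[X]) * (ν + 1) * t ^ ν * (t + t ^ 2) * hhalf
  rw [h1, ← smul_eq_C_mul, map_smul, weightedDeriv_apply, h2, hX, smul_eq_C_mul, smul_eq_C_mul,
    smul_eq_C_mul, div_eq_mul_one_div]
  simp only [C_mul, C_add, C_1, map_natCast, C_neg]
  linear_combination -((ν : ℝ[X]) + 1) * t ^ ν *
    ((ν : ℝ[X]) * (1 + t) + C b * t + C a * (1 + t)) * hhalf

/-- Jacobi's differential equation. -/
theorem weightedDeriv_derivative_jacobiP (a b : ℝ) (n : ℕ) :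
    weightedDeriv a b (derivative (jacobiP (a - 1) (b - 1) n)) =
      -((n : ℝ) * (n + a + b - 1)) • jacobiP (a - 1) (b - 1) n := by
  rw [jacobiP_eq_sum, derivative_smul, map_smul, smul_comm]
  congr 1
  rw [derivative_sum, map_sum, Finset.sum_range_succ', Finset.smul_sum]
  set t : ℝ[X] := C (1 / 2 : ℝ) * (X - 1) with ht
  have h0 : weightedDeriv a b (derivative (jacobiCoeff a b n 0 • t ^ 0)) = 0 := by
    simp
  have h1 : ∀ ν ∈ Finset.range n,
      weightedDeriv a b (derivative (jacobiCoeff a b n (ν + 1) • t ^ (ν + 1))) =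
      -((n - ν : ℝ) * (n + ν + a + b - 1) * jacobiCoeff a b n ν) • t ^ ν -
      ((((ν + 1 : ℕ) : ℝ)) * ((ν + 1 : ℕ) + a + b - 1) * jacobiCoeff a b n (ν + 1)) •
        t ^ (ν + 1) := by
    intro ν hν
    rw [derivative_smul, map_smul, weightedDeriv_derivative_pow_succ,
      ← jacobiCoeff_succ a b (Finset.mem_range.1 hν), smul_sub, smul_smul, smul_smul]
    congr 2
    · ring
    · push_cast; ring
  -- The added top term carries the factor n - ν = 0; in the shifted sum of `h3` the added bottom
  -- term carries ν = 0.
  have h2 : ∑ ν ∈ Finset.range n, -((n - ν : ℝ) * (n + ν + a + b - 1) *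
      jacobiCoeff a b n ν) • t ^ ν = ∑ ν ∈ Finset.range (n + 1), -((n - ν : ℝ) *
      (n + ν + a + b - 1) * jacobiCoeff a b n ν) • t ^ ν := by
    rw [Finset.sum_range_succ]
    simp
  have h3 : ∑ ν ∈ Finset.range n, ((((ν + 1 : ℕ) : ℝ)) * ((ν + 1 : ℕ) + a + b - 1) *
      jacobiCoeff a b n (ν + 1)) • t ^ (ν + 1) = ∑ ν ∈ Finset.range (n + 1),
      ((ν : ℝ) * (ν + a + b - 1) * jacobiCoeff a b n ν) • t ^ ν := by
    rw [Finset.sum_range_succ' (fun ν : ℕ => ((ν : ℝ) * (ν + a + b - 1) *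
      jacobiCoeff a b n ν) • t ^ ν)]
    simp
  rw [h0, add_zero, Finset.sum_congr rfl h1, Finset.sum_sub_distrib, h2, h3,
    ← Finset.sum_sub_distrib]
  refine Finset.sum_congr rfl fun ν _ => ?_
  rw [smul_smul, ← sub_smul]
  congr 1
  ring

theorem natDegree_half_X_sub_one_pow_le (ν : ℕ) :
    ((C (1 / 2 : ℝ) * (X - 1)) ^ ν : ℝ[X]).natDegree ≤ ν := by
  compute_degree

theorem natDegree_jacobiP_le (a b : ℝ) (n : ℕ) : (jacobiP (a - 1) (b - 1) n).natDegree ≤ n := by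
  rw [jacobiP_eq_sum]
  refine (natDegree_smul_le _ _).trans (natDegree_sum_le_of_forall_le _ _ fun ν hν => ?_)
  refine (natDegree_smul_le _ _).trans ((natDegree_half_X_sub_one_pow_le ν).trans ?_)
  have := Finset.mem_range.1 hν
  omega

theorem coeff_jacobiP (a b : ℝ) (n : ℕ) : (jacobiP (a - 1) (b - 1) n).coeff n =
    (n ! : ℝ)⁻¹ * (ascPochhammer ℝ n).eval ((n : ℝ) + a + b - 1) * (1 / 2) ^ n := by
  rw [jacobiP_eq_sum, coeff_smul, finsetSum_coeff, Finset.sum_eq_single n]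
  · have h : ((C (1 / 2 : ℝ) * (X - 1)) ^ n : ℝ[X]).coeff n = (1 / 2) ^ n := by
      rw [mul_pow, ← C_pow, coeff_C_mul, ← C_1]
      have := ((monic_X_sub_C (1 : ℝ)).pow n).coeff_natDegree
      rw [natDegree_pow, natDegree_X_sub_C, mul_one] at this
      rw [this, mul_one]
    rw [coeff_smul, h]
    simp [jacobiCoeff]
    ring
  · intro ν hν hne
    have := Finset.mem_range.1 hν
    rw [coeff_smul, coeff_eq_zero_of_natDegree_lt, smul_zero]
    exact (natDegree_half_X_sub_one_pow_le ν).trans_lt (by omega)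
  · simp

theorem eval_one_jacobiP (a b : ℝ) (n : ℕ) : (jacobiP (a - 1) (b - 1) n).eval 1 =
    (n ! : ℝ)⁻¹ * (ascPochhammer ℝ n).eval a := by
  rw [jacobiP_eq_sum, eval_smul, eval_finsetSum, Finset.sum_eq_single 0]
  · simp [jacobiCoeff]
  · intro ν _ hν
    simp [hν]
  · simp

variable {a b : ℝ} (ha : 0 < a) (hb : 0 < b)

include ha hb in
theorem coeff_jacobiP_pos (n : ℕ) : 0 < (jacobiP (a - 1) (b - 1) n).coeff n := by
  rw [coeff_jacobiP]
  have h : 0 < (ascPochhammer ℝ n).eval ((n : ℝ) + a + b - 1) := by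
    rcases n with _ | n
    · simp
    · refine ascPochhammer_pos _ _ ?_
      push_cast
      have : (0 : ℝ) ≤ n := n.cast_nonneg
      linarith
  positivity

theorem coeff_jacobiP_succ (a b : ℝ) (n : ℕ) :
    2 * ((n : ℝ) + 1) * (n + a + b - 1) * (jacobiP (a - 1) (b - 1) (n + 1)).coeff (n + 1) =
      (2 * n + a + b - 1) * (2 * n + a + b) * (jacobiP (a - 1) (b - 1) n).coeff n := by
  have h : (ascPochhammer ℝ (n + 1 + 1)).eval ((n : ℝ) + a + b - 1) =
      ((n : ℝ) + a + b - 1) *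
        (ascPochhammer ℝ (n + 1)).eval (((n + 1 : ℕ) : ℝ) + a + b - 1) := by
    rw [ascPochhammer_succ_left, eval_mul, eval_comp, eval_X]
    simp only [eval_add, eval_X, eval_one]
    push_cast
    congr 2
    ring
  rw [ascPochhammer_succ_eval, ascPochhammer_succ_eval] at h
  rw [coeff_jacobiP, coeff_jacobiP, Nat.factorial_succ, pow_succ]
  push_cast at h ⊢
  have h1 : ((n : ℝ) + 1) ≠ 0 := by positivity
  have h2 : (n ! : ℝ) ≠ 0 := by positivity
  rw [mul_inv]
  field_simp
  linear_combination -h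

theorem eval_one_jacobiP_succ (a b : ℝ) (n : ℕ) :
    ((n : ℝ) + 1) * (jacobiP (a - 1) (b - 1) (n + 1)).eval 1 =
      (a + n) * (jacobiP (a - 1) (b - 1) n).eval 1 := by
  rw [eval_one_jacobiP, eval_one_jacobiP, ascPochhammer_succ_eval, Nat.factorial_succ]
  push_cast
  have h1 : ((n : ℝ) + 1) ≠ 0 := by positivity
  have h2 : (n ! : ℝ) ≠ 0 := by positivity
  field_simp

include ha in
theorem eval_one_jacobiP_pos (b : ℝ) (n : ℕ) : 0 < (jacobiP (a - 1) (b - 1) n).eval 1 := by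
  rw [eval_one_jacobiP]
  have := ascPochhammer_pos n a ha
  positivity

/-- Sturm–Liouville argument: the Jacobi operator is symmetric for the functional, and its
eigenvalues differ by (n-m)(n+m+a+b-1), which is nonzero since n + m ≥ 1. -/
theorem jacobiFunctional_jacobiP_mul_of_ne {n m : ℕ} (h : n ≠ m) :
    jacobiFunctional ha hb (jacobiP (a - 1) (b - 1) n * jacobiP (a - 1) (b - 1) m) = 0 := by
  have key : ∀ p q : ℝ[X], jacobiFunctional ha hb (weightedDeriv a b (derivative p) * q) =
      -jacobiFunctional ha hb ((1 - X ^ 2) * (derivative p * derivative q)) := by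
    intro p q
    have h := jacobiFunctional_weightedDeriv ha hb (derivative p * q)
    rw [weightedDeriv_mul, map_add] at h
    linarith
  have h1 := key (jacobiP (a - 1) (b - 1) n) (jacobiP (a - 1) (b - 1) m)
  have h2 := key (jacobiP (a - 1) (b - 1) m) (jacobiP (a - 1) (b - 1) n)
  rw [weightedDeriv_derivative_jacobiP, smul_mul_assoc, map_smul, smul_eq_mul] at h1 h2
  rw [mul_comm (jacobiP _ _ m)] at h2
  rw [mul_comm (derivative (jacobiP _ _ m))] at h2
  have h3 : ((n : ℝ) - m) * (n + m + a + b - 1) *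
      jacobiFunctional ha hb (jacobiP (a - 1) (b - 1) n * jacobiP (a - 1) (b - 1) m) = 0 := by
    linear_combination h2 - h1
  refine (mul_eq_zero.1 h3).resolve_left (mul_ne_zero (sub_ne_zero.2 (by exact_mod_cast h)) ?_)
  have : (1 : ℝ) ≤ n + m := by exact_mod_cast (by omega : 1 ≤ n + m)
  linarith

theorem jacobiNormSq_eq (n : ℕ) : jacobiNormSq (a - 1) (b - 1) n =
    jacobiFunctional ha hb (jacobiP (a - 1) (b - 1) n * jacobiP (a - 1) (b - 1) n) := by
  simp only [jacobiNormSq, jacobiFunctional_apply, eval_mul, pow_two]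

include ha hb in
theorem jacobiNormSq_pos (n : ℕ) : 0 < jacobiNormSq (a - 1) (b - 1) n := by
  rw [jacobiNormSq_eq ha hb, ← pow_two]
  refine jacobiFunctional_sq_pos ha hb fun h => ?_
  have := coeff_jacobiP_pos ha hb n
  simp [h] at this

/-- The orthonormal Jacobi polynomials for the weight `(1-x)^(a-1) (1+x)^(b-1)`. -/
def orthoJacobi (a b : ℝ) (n : ℕ) : ℝ[X] :=
  (√(jacobiNormSq (a - 1) (b - 1) n))⁻¹ • jacobiP (a - 1) (b - 1) n

theorem jacobiFunctional_orthoJacobi_mul (n m : ℕ) :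
    jacobiFunctional ha hb (orthoJacobi a b n * orthoJacobi a b m) = if n = m then 1 else 0 := by
  simp only [orthoJacobi, smul_mul_assoc, mul_smul_comm, map_smul, smul_eq_mul]
  split_ifs with h
  · subst h
    rw [← jacobiNormSq_eq]
    have h1 := jacobiNormSq_pos ha hb n
    have h2 := Real.mul_self_sqrt h1.le
    have h3 := (Real.sqrt_pos.2 h1).ne'
    field_simp
    linarith
  · rw [jacobiFunctional_jacobiP_mul_of_ne ha hb h]
    simp

include ha hb in
theorem coeff_orthoJacobi_pos (n : ℕ) : 0 < (orthoJacobi a b n).coeff n := by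
  rw [orthoJacobi, coeff_smul, smul_eq_mul]
  exact mul_pos (inv_pos.2 (Real.sqrt_pos.2 (jacobiNormSq_pos ha hb n))) (coeff_jacobiP_pos ha hb n)

theorem natDegree_orthoJacobi_le (a b : ℝ) (n : ℕ) : (orthoJacobi a b n).natDegree ≤ n :=
  (natDegree_smul_le _ _).trans (natDegree_jacobiP_le a b n)

include ha hb in
theorem natDegree_orthoJacobi (n : ℕ) : (orthoJacobi a b n).natDegree = n :=
  natDegree_eq_of_le_of_coeff_ne_zero (natDegree_orthoJacobi_le a b n)
    (coeff_orthoJacobi_pos ha hb n).ne'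

include ha hb in
theorem exists_eq_sum_smul_orthoJacobi (n : ℕ) : ∀ q : ℝ[X], q.degree < n →
    ∃ c : ℕ → ℝ, q = ∑ k ∈ Finset.range n, c k • orthoJacobi a b k := by
  induction n with
  | zero => exact fun q hq => ⟨0, by simpa using hq⟩
  | succ n ih =>
    intro q hq
    have hpos := coeff_orthoJacobi_pos ha hb n
    set r := q.coeff n / (orthoJacobi a b n).coeff n with hr
    obtain ⟨c, hc⟩ := ih (q - r • orthoJacobi a b n) (by
      rw [degree_lt_iff_coeff_zero] at hq ⊢
      intro m hm
      rcases hm.eq_or_lt with rfl | hm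
      · simp [hr, hpos.ne']
      · rw [coeff_sub, coeff_smul, hq m hm, coeff_eq_zero_of_natDegree_lt
          ((natDegree_orthoJacobi_le a b n).trans_lt hm)]
        simp)
    refine ⟨fun k => if k = n then r else c k, ?_⟩
    rw [Finset.sum_range_succ]
    simp only [↓reduceIte]
    rw [Finset.sum_congr rfl (g := fun k =>
      c k • orthoJacobi a b k) (fun k hk => by
        rw [if_neg (Finset.mem_range.1 hk).ne]), ← hc]
    simp

theorem eq_sum_jacobiFunctional_smul {n : ℕ} {q : ℝ[X]} (hq : q.degree < n) :
    q = ∑ k ∈ Finset.range n, jacobiFunctional ha hb (q * orthoJacobi a b k) •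
      orthoJacobi a b k := by
  obtain ⟨c, hc⟩ := exists_eq_sum_smul_orthoJacobi ha hb n q hq
  conv_lhs => rw [hc]
  refine Finset.sum_congr rfl fun k hk => ?_
  congr 1
  rw [hc, Finset.sum_mul, map_sum, Finset.sum_eq_single k]
  · simp [jacobiFunctional_orthoJacobi_mul]
  · intro j _ hj
    simp [jacobiFunctional_orthoJacobi_mul, hj]
  · simp [hk]

theorem jacobiFunctional_mul_orthoJacobi_eq_zero {n : ℕ} {q : ℝ[X]} (hq : q.degree < n) :
    jacobiFunctional ha hb (q * orthoJacobi a b n) = 0 := by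
  obtain ⟨c, hc⟩ := exists_eq_sum_smul_orthoJacobi ha hb n q hq
  rw [hc, Finset.sum_mul, map_sum]
  refine Finset.sum_eq_zero fun k hk => ?_
  rw [smul_mul_assoc, map_smul, jacobiFunctional_orthoJacobi_mul,
    if_neg (Finset.mem_range.1 hk).ne, smul_zero]

/-- The matrix elements of `d/dx` in the basis `orthoJacobi a b k · (1-x)^(a/2) (1+x)^(b/2)`. -/
def derivMatrix (j k : ℕ) : ℝ :=
  jacobiFunctional ha hb (weightedDeriv (a / 2) (b / 2) (orthoJacobi a b j) * orthoJacobi a b k)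

/-- D_jk + D_kj integrates the derivative of p_j p_k (1-x)^a (1+x)^b, which vanishes at both
endpoints. -/
theorem derivMatrix_antisymm (j k : ℕ) : derivMatrix ha hb j k = -derivMatrix ha hb k j := by
  have h := jacobiFunctional_weightedDeriv ha hb (orthoJacobi a b j * orthoJacobi a b k)
  have h2 := weightedDeriv_add_mul (a / 2) (b / 2) (a / 2) (b / 2) (orthoJacobi a b j)
    (orthoJacobi a b k)
  rw [add_halves, add_halves] at h2
  rw [h2, map_add, mul_comm (orthoJacobi a b j)] at h
  unfold derivMatrix
  linarith

theorem derivMatrix_self (j : ℕ) : derivMatrix ha hb j j = 0 := by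
  have := derivMatrix_antisymm ha hb j j
  linarith

theorem degree_weightedDeriv_orthoJacobi_lt (c d : ℝ) {j n : ℕ} (h : j + 1 < n) :
    (weightedDeriv c d (orthoJacobi a b j)).degree < n := by
  refine lt_of_le_of_lt degree_le_natDegree ?_
  have := natDegree_weightedDeriv_le c d (natDegree_orthoJacobi_le a b j)
  exact_mod_cast this.trans_lt h

theorem derivMatrix_eq_zero {j k : ℕ} (h : j + 1 < k) : derivMatrix ha hb j k = 0 :=
  jacobiFunctional_mul_orthoJacobi_eq_zero ha hb (degree_weightedDeriv_orthoJacobi_lt _ _ h)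

theorem weightedDeriv_orthoJacobi {j n : ℕ} (h : j + 1 < n) :
    weightedDeriv (a / 2) (b / 2) (orthoJacobi a b j) =
      ∑ k ∈ Finset.range n, derivMatrix ha hb j k • orthoJacobi a b k :=
  eq_sum_jacobiFunctional_smul ha hb (degree_weightedDeriv_orthoJacobi_lt _ _ h)

theorem derivMatrix_succ_mul_coeff (n : ℕ) :
    derivMatrix ha hb n (n + 1) * (orthoJacobi a b (n + 1)).coeff (n + 1) =
      -(n + (a + b) / 2) * (orthoJacobi a b n).coeff n := by
  have h := congrArg (fun q => q.coeff (n + 1))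
    (weightedDeriv_orthoJacobi ha hb (j := n) (n := n + 2) (by omega))
  simp only [coeff_weightedDeriv _ _ (natDegree_orthoJacobi_le a b n), finsetSum_coeff,
    coeff_smul, smul_eq_mul] at h
  rw [Finset.sum_range_succ, Finset.sum_eq_zero, zero_add] at h
  · rw [← h]
    ring
  · intro k hk
    rw [coeff_eq_zero_of_natDegree_lt, mul_zero]
    exact (natDegree_orthoJacobi_le a b k).trans_lt (Finset.mem_range.1 hk)

/-- At x = 1 the term with the derivative drops out of the weighted derivative, leaving -a times the
value. This is a second relation between neighbouring matrix entries, besides the one from leading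
coefficients. -/
theorem derivMatrix_eval_one (n : ℕ) :
    -a * (orthoJacobi a b (n + 1)).eval 1 =
      -derivMatrix ha hb n (n + 1) * (orthoJacobi a b n).eval 1 +
        derivMatrix ha hb (n + 1) (n + 2) * (orthoJacobi a b (n + 2)).eval 1 := by
  have h := congrArg (fun q => q.eval 1)
    (weightedDeriv_orthoJacobi ha hb (j := n + 1) (n := n + 3) (by omega))
  simp only [eval_finsetSum, eval_smul, smul_eq_mul] at h
  rw [Finset.sum_range_succ, Finset.sum_range_succ, Finset.sum_range_succ, Finset.sum_eq_zero,
    derivMatrix_self, derivMatrix_antisymm ha hb (n + 1) n] at h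
  · simp only [weightedDeriv_apply, eval_add, eval_mul, eval_sub, eval_one, eval_pow, eval_X,
      eval_C] at h
    linarith
  · intro k hk
    rw [derivMatrix_antisymm, derivMatrix_eq_zero ha hb (by have := Finset.mem_range.1 hk; omega)]
    simp

theorem derivMatrix_succ_mul_sqrt {n : ℕ} (hn : 1 ≤ n) :
    derivMatrix ha hb n (n + 1) * √(jacobiNormSq (a - 1) (b - 1) n) =
      -((n + 1) * (n + a + b - 1) / (2 * n + a + b - 1)) *
        √(jacobiNormSq (a - 1) (b - 1) (n + 1)) := by
  have hn1 : (1 : ℝ) ≤ n := by exact_mod_cast hn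
  have e1 := derivMatrix_succ_mul_coeff ha hb n
  simp only [orthoJacobi, coeff_smul, smul_eq_mul] at e1
  have l0 := coeff_jacobiP_pos ha hb n
  have l1 := coeff_jacobiP_succ a b n
  have s0 := Real.sqrt_pos.2 (jacobiNormSq_pos ha hb n)
  have s1 := Real.sqrt_pos.2 (jacobiNormSq_pos ha hb (n + 1))
  set D := derivMatrix ha hb n (n + 1)
  set t0 := √(jacobiNormSq (a - 1) (b - 1) n)
  set t1 := √(jacobiNormSq (a - 1) (b - 1) (n + 1))
  set k0 := (jacobiP (a - 1) (b - 1) n).coeff n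
  set k1 := (jacobiP (a - 1) (b - 1) (n + 1)).coeff (n + 1)
  have hA : 0 < 2 * (n : ℝ) + a + b - 1 := by linarith
  have hA' : 0 < 2 * (n : ℝ) + a + b := by linarith
  have e2 : D * t0 * k1 = -(n + (a + b) / 2) * k0 * t1 := by
    field_simp at e1 ⊢
    linarith
  have h0 : (2 * (n : ℝ) + a + b) * k0 ≠ 0 := by positivity
  rw [← neg_div, div_mul_eq_mul_div, eq_div_iff hA.ne']
  apply mul_left_cancel₀ h0
  linear_combination (2 * ((n : ℝ) + 1) * (n + a + b - 1)) * e2 - D * t0 * l1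

/-- Leading coefficients give D_{n,n+1} as a rational multiple of √(h_{n+1}/h_n). Using this at n =
2N+1 in the relation at x = 1 gives D_{2N,2N+1} √(h_{2N+1}/h_{2N}) rationally as well. The two
combine to a formula for D_{2N,2N+1}² free of the norms, and the sign comes from the first one. N ≥
1 makes 4N+a+b-1 positive. -/
theorem derivMatrix_two_mul {N : ℕ} (hN : 1 ≤ N) :
    derivMatrix ha hb (2 * N) (2 * N + 1) = -constC4 a b N := by
  have h1 := derivMatrix_succ_mul_sqrt ha hb (n := 2 * N) (by omega)
  have h2 := derivMatrix_succ_mul_sqrt ha hb (n := 2 * N + 1) (by omega)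
  have e3 := derivMatrix_eval_one ha hb (2 * N)
  simp only [orthoJacobi, eval_smul, smul_eq_mul] at e3
  have v0 := eval_one_jacobiP_pos ha b (2 * N)
  have v1 := eval_one_jacobiP_succ a b (2 * N)
  have v2 := eval_one_jacobiP_succ a b (2 * N + 1)
  have s0 := Real.sqrt_pos.2 (jacobiNormSq_pos ha hb (2 * N))
  have s1 := Real.sqrt_pos.2 (jacobiNormSq_pos ha hb (2 * N + 1))
  have s2 := Real.sqrt_pos.2 (jacobiNormSq_pos ha hb (2 * N + 2))
  have hN1 : (1 : ℝ) ≤ N := by exact_mod_cast hN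
  unfold constC4
  push_cast at *
  simp only [add_assoc, one_add_one_eq_two] at *
  generalize derivMatrix ha hb (2 * N) (2 * N + 1) = D at *
  generalize derivMatrix ha hb (2 * N + 1) (2 * N + 2) = D' at *
  generalize √(jacobiNormSq (a - 1) (b - 1) (2 * N)) = t0 at *
  generalize √(jacobiNormSq (a - 1) (b - 1) (2 * N + 1)) = t1 at *
  generalize √(jacobiNormSq (a - 1) (b - 1) (2 * N + 2)) = t2 at *
  generalize (jacobiP (a - 1) (b - 1) (2 * N)).eval 1 = y0 at *
  generalize (jacobiP (a - 1) (b - 1) (2 * N + 1)).eval 1 = y1 at *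
  generalize (jacobiP (a - 1) (b - 1) (2 * N + 2)).eval 1 = y2 at *
  generalize (N : ℝ) = x at *
  have p1 : 0 < 2 * (2 * x) + (a + b) - 1 := by linarith
  have p2 : 0 < 2 * (2 * x) + (a + b) + 1 := by linarith
  have hA0 : 0 < (2 * x + 1) * (2 * x + (a + b) - 1) / (2 * (2 * x) + (a + b) - 1) :=
    div_pos (mul_pos (by linarith) (by linarith)) p1
  have hD : D = -((2 * x + 1) * (2 * x + (a + b) - 1) / (2 * (2 * x) + (a + b) - 1)) *
      (t1 / t0) := by
    rw [← mul_div_assoc, ← h1, mul_div_cancel_right₀ _ s0.ne']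
  have hD' : D' * (t1 / t2) =
      -((2 * x + 2) * (2 * x + (1 + (a + b)) - 1) / (2 * (2 * x + 1) + (a + b) - 1)) := by
    rw [← mul_div_assoc, h2, mul_div_cancel_right₀ _ s2.ne']
  have e4 : -a * y1 = -(D * (t1 / t0)) * y0 + D' * (t1 / t2) * y2 := by
    have := congrArg (fun z => t1 * z) e3
    beta_reduce at this
    rw [show t1 * (-a * (t1⁻¹ * y1)) = -a * y1 by field_simp] at this
    rw [this]
    ring
  have hy1 : y1 = (a + 2 * x) * y0 / (2 * x + 1) := by
    rw [eq_div_iff (by linarith)]; linarith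
  have hy2 : y2 = (a + (2 * x + 1)) * y1 / (2 * x + 2) := by
    rw [eq_div_iff (by linarith)]; linarith
  have hr : D * (t1 / t0) = -((2 * x + a) * (2 * x + b) / (4 * x + (a + (b + 1)))) := by
    rw [hD', hy2, hy1] at e4
    have q1 : 2 * (2 * x + 1) + (a + b) - 1 ≠ 0 := by linarith
    have q2 : 4 * x + (a + (b + 1)) ≠ 0 := by linarith
    have q3 : 2 * x + 1 ≠ 0 := by linarith
    have q4 : 2 * x + 2 ≠ 0 := by linarith
    apply mul_right_cancel₀ v0.ne'
    have e5 : D * (t1 / t0) * y0 = a * ((a + 2 * x) * y0 / (2 * x + 1)) +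
        -((2 * x + 2) * (2 * x + (1 + (a + b)) - 1) / (2 * (2 * x + 1) + (a + b) - 1)) *
        ((a + (2 * x + 1)) * ((a + 2 * x) * y0 / (2 * x + 1)) / (2 * x + 2)) := by
      linarith
    rw [e5, show 2 * (2 * x + 1) + (a + b) - 1 = 4 * x + (a + (b + 1)) by ring]
    field_simp
    ring
  have hneg : 0 ≤ -D := by
    rw [hD, neg_mul, neg_neg]
    positivity
  have hsq : (2 * x + 1) * (2 * x + a) * (2 * x + b) * (2 * x + (a + b) - 1) /
      ((4 * x + (a + (b + 1))) * (4 * x + (a + b) - 1)) = (-D) ^ 2 := by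
    have : (-D) ^ 2 = ((2 * x + 1) * (2 * x + (a + b) - 1) / (2 * (2 * x) + (a + b) - 1)) *
        -(D * (t1 / t0)) := by
      conv_lhs => rw [neg_sq, pow_two]
      nth_rewrite 2 [hD]
      ring
    rw [this, hr, neg_neg, div_mul_div_comm]
    congr 1 <;> ring
  rw [hsq, Real.sqrt_sq hneg, neg_neg]

end JacobiPolynomials

/-! ### The operator ε as an antiderivative. -/

section EpsOperator

theorem setIntegral_Icc_eq {E : Type*} [NormedAddCommGroup E] [NormedSpace ℝ E] (g : ℝ → E) :
    ∫ x in Icc (-1 : ℝ) 1, g x = ∫ x in (-1 : ℝ)..1, g x := by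
  rw [intervalIntegral.integral_of_le (by norm_num), integral_Icc_eq_integral_Ioc]

theorem intervalIntegrable_iff_Icc {E : Type*} [NormedAddCommGroup E] {g : ℝ → E} :
    IntervalIntegrable g volume (-1) 1 ↔ IntegrableOn g (Icc (-1 : ℝ) 1) :=
  intervalIntegrable_iff_integrableOn_Icc_of_le (by norm_num)

theorem measurable_real_sign : Measurable Real.sign := by
  unfold Real.sign
  exact Measurable.ite measurableSet_Iio measurable_const
    (Measurable.ite measurableSet_Ioi measurable_const measurable_const)

theorem abs_epsKernel_le (x y : ℝ) : ‖epsKernel x y‖ ≤ 1 := by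
  unfold epsKernel
  rcases Real.sign_apply_eq (x - y) with h | h | h <;> rw [h] <;> norm_num

theorem epsKernel_swap (x y : ℝ) : epsKernel x y = -epsKernel y x := by
  unfold epsKernel
  rw [← neg_sub y x, Real.sign_neg]
  ring

theorem intervalIntegrable_epsKernel_mul {g : ℝ → ℝ} (hg : IntervalIntegrable g volume (-1) 1)
    (x : ℝ) : IntervalIntegrable (fun y => epsKernel x y * g y) volume (-1) 1 := by
  rw [intervalIntegrable_iff_Icc] at hg ⊢
  refine Integrable.bdd_mul hg (c := 1) ?_ (ae_of_all _ fun y => abs_epsKernel_le x y)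
  exact (measurable_const.mul
    (measurable_real_sign.comp (measurable_const.sub measurable_id))).aestronglyMeasurable

theorem eps_sum_mul {ι : Type*} (s : Finset ι) (c : ι → ℝ) (g : ι → ℝ → ℝ)
    (hg : ∀ i ∈ s, IntervalIntegrable (g i) volume (-1) 1) (x : ℝ) :
    eps (fun y => ∑ i ∈ s, c i * g i y) x = ∑ i ∈ s, c i * eps (g i) x := by
  unfold eps
  simp_rw [Finset.mul_sum, ← intervalIntegral.integral_const_mul, mul_left_comm _ (c _)]
  rw [intervalIntegral.integral_finsetSum]
  exact fun i hi => (intervalIntegrable_epsKernel_mul (hg i hi) x).const_mul _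

theorem eps_eq_primitive {g : ℝ → ℝ} (hg : IntervalIntegrable g volume (-1) 1) {x : ℝ}
    (hx : x ∈ Icc (-1 : ℝ) 1) :
    eps g x = (∫ y in (-1 : ℝ)..x, g y) - 1 / 2 * ∫ y in (-1 : ℝ)..1, g y := by
  have hi := intervalIntegrable_epsKernel_mul hg x
  have hx' : x ∈ uIcc (-1 : ℝ) 1 := by rwa [uIcc_of_le (by norm_num)]
  have hL : uIcc (-1 : ℝ) x ⊆ uIcc (-1) 1 := uIcc_subset_uIcc_left hx'
  have hR : uIcc x 1 ⊆ uIcc (-1 : ℝ) 1 := uIcc_subset_uIcc_right hx'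
  unfold eps
  rw [← intervalIntegral.integral_add_adjacent_intervals (hi.mono_set hL) (hi.mono_set hR),
    ← intervalIntegral.integral_add_adjacent_intervals (hg.mono_set hL) (hg.mono_set hR)]
  have h1 : ∫ y in (-1 : ℝ)..x, epsKernel x y * g y = ∫ y in (-1 : ℝ)..x, 1 / 2 * g y :=
    intervalIntegral.integral_congr_Ioo_of_le hx.1 fun y hy => by
      simp only [epsKernel, Real.sign_of_pos (sub_pos.2 hy.2), mul_one]
  have h2 : ∫ y in x..1, epsKernel x y * g y = ∫ y in x..1, -(1 / 2) * g y :=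
    intervalIntegral.integral_congr_Ioo_of_le hx.2 fun y hy => by
      simp only [epsKernel, Real.sign_of_neg (sub_neg.2 hy.1), mul_neg, mul_one]
  rw [h1, h2, intervalIntegral.integral_const_mul, intervalIntegral.integral_const_mul]
  ring

theorem continuousOn_eps {g : ℝ → ℝ} (hg : IntervalIntegrable g volume (-1) 1) :
    ContinuousOn (eps g) (Icc (-1) 1) := by
  have h := (intervalIntegral.continuousOn_primitive_interval' hg left_mem_uIcc).sub
    (continuousOn_const (c := 1 / 2 * ∫ y in (-1 : ℝ)..1, g y))
  rw [uIcc_of_le (by norm_num)] at h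
  exact h.congr fun x hx => eps_eq_primitive hg hx

theorem hasDerivAt_eps {g : ℝ → ℝ} (hg : IntervalIntegrable g volume (-1) 1)
    (hc : ContinuousOn g (Ioo (-1) 1)) {x : ℝ} (hx : x ∈ Ioo (-1 : ℝ) 1) :
    HasDerivAt (eps g) (g x) x := by
  have hmem : Ioo (-1 : ℝ) 1 ∈ nhds x := isOpen_Ioo.mem_nhds hx
  have hL : uIcc (-1 : ℝ) x ⊆ uIcc (-1) 1 :=
    uIcc_subset_uIcc_left (by rw [uIcc_of_le (by norm_num)]; exact Ioo_subset_Icc_self hx)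
  have h := intervalIntegral.integral_hasDerivAt_right (hg.mono_set hL)
    (hc.stronglyMeasurableAtFilter isOpen_Ioo x hx) (hc.continuousAt hmem)
  refine (h.sub_const (1 / 2 * ∫ y in (-1 : ℝ)..1, g y)).congr_of_eventuallyEq ?_
  filter_upwards [hmem] with y hy
  exact eps_eq_primitive hg (Ioo_subset_Icc_self hy)

/-- The operator `ε` inverts differentiation on functions vanishing at `±1`. -/
theorem eps_deriv_eq {u g : ℝ → ℝ} (hg : IntervalIntegrable g volume (-1) 1)
    (hu : ContinuousOn u (Icc (-1) 1)) (hd : ∀ x ∈ Ioo (-1 : ℝ) 1, HasDerivAt u (g x) x)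
    (h0 : u (-1) = 0) (h1 : u 1 = 0) {x : ℝ} (hx : x ∈ Icc (-1 : ℝ) 1) : eps g x = u x := by
  have hL : uIcc (-1 : ℝ) x ⊆ uIcc (-1) 1 :=
    uIcc_subset_uIcc_left (by rwa [uIcc_of_le (by norm_num)])
  rw [eps_eq_primitive hg hx, intervalIntegral.integral_eq_sub_of_hasDerivAt_of_le hx.1
      (hu.mono (Icc_subset_Icc_right hx.2)) (fun y hy => hd y ⟨hy.1, hy.2.trans_le hx.2⟩)
      (hg.mono_set hL),
    intervalIntegral.integral_eq_sub_of_hasDerivAt_of_le (by norm_num) hu hd hg, h0, h1]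
  ring

end EpsOperator

/-! ### The dual systems u_k and φ_k. -/

section HalfWeights

open Polynomial

/-- `p(x) (1-x)^(a/2-1) (1+x)^(b/2-1)`. -/
def phiFun (a b : ℝ) (p : ℝ[X]) (x : ℝ) : ℝ := p.eval x * jacobiWeight (a / 2 - 1) (b / 2 - 1) x

/-- `p(x) (1-x)^(a/2) (1+x)^(b/2)`. -/
def uFun (a b : ℝ) (p : ℝ[X]) (x : ℝ) : ℝ := p.eval x * jacobiWeight (a / 2) (b / 2) x

theorem phi4_eq_phiFun (a b : ℝ) (j : ℕ) : phi4 a b j = phiFun a b (orthoJacobi a b j) := by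
  ext x
  simp only [phi4, phiFun, orthoJacobi, jacobiWeight, eval_smul, smul_eq_mul]
  ring

theorem phiFun_sum_smul (a b : ℝ) {ι : Type*} (s : Finset ι) (c : ι → ℝ) (p : ι → ℝ[X]) :
    phiFun a b (∑ i ∈ s, c i • p i) = fun x => ∑ i ∈ s, c i * phiFun a b (p i) x := by
  ext x
  simp only [phiFun, eval_finsetSum, eval_smul, smul_eq_mul, Finset.sum_mul, mul_assoc]

variable {a b : ℝ} (ha : 0 < a) (hb : 0 < b)

include ha hb in
theorem intervalIntegrable_phiFun (p : ℝ[X]) :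
    IntervalIntegrable (phiFun a b p) volume (-1) 1 :=
  intervalIntegrable_mul_jacobiWeight (by linarith) (by linarith) p

theorem continuousOn_phiFun (a b : ℝ) (p : ℝ[X]) : ContinuousOn (phiFun a b p) (Ioo (-1) 1) := by
  refine p.continuousOn.mul (ContinuousOn.mul ?_ ?_)
  · exact (continuousOn_const.sub continuousOn_id).rpow_const fun x hx =>
      Or.inl (sub_pos.2 hx.2).ne'
  · exact (continuousOn_const.add continuousOn_id).rpow_const fun x hx =>
      Or.inl (by change 1 + x ≠ 0; exact (by linarith [hx.1] : 0 < 1 + x).ne')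

include ha hb in
theorem continuous_uFun (p : ℝ[X]) : Continuous (uFun a b p) :=
  p.continuous.mul (continuous_jacobiWeight (by linarith) (by linarith))

include ha in
theorem uFun_one (b : ℝ) (p : ℝ[X]) : uFun a b p 1 = 0 := by
  rw [uFun, jacobiWeight_one (by positivity), mul_zero]

include hb in
theorem uFun_neg_one (a : ℝ) (p : ℝ[X]) : uFun a b p (-1) = 0 := by
  rw [uFun, jacobiWeight_neg_one _ (by positivity), mul_zero]

theorem hasDerivAt_uFun (a b : ℝ) (p : ℝ[X]) {x : ℝ} (hx : x ∈ Ioo (-1 : ℝ) 1) :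
    HasDerivAt (uFun a b p) (phiFun a b (weightedDeriv (a / 2) (b / 2) p) x) x :=
  hasDerivAt_mul_jacobiWeight (a / 2) (b / 2) p hx

include ha hb in
theorem one_sub_sq_mul_phiFun (p : ℝ[X]) {x : ℝ} (hx : x ∈ Icc (-1 : ℝ) 1) :
    (1 - x ^ 2) * phiFun a b p x = uFun a b p x := by
  rcases eq_endpoints_or_mem_Ioo_of_mem_Icc hx with rfl | rfl | h
  · rw [uFun_neg_one hb]; norm_num
  · rw [uFun_one ha]; norm_num
  · rw [uFun, phiFun, jacobiWeight_eq_mul (a / 2) (b / 2) h]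
    ring

include ha hb in
theorem eps_phiFun_weightedDeriv (p : ℝ[X]) {x : ℝ} (hx : x ∈ Icc (-1 : ℝ) 1) :
    eps (phiFun a b (weightedDeriv (a / 2) (b / 2) p)) x = uFun a b p x :=
  eps_deriv_eq (intervalIntegrable_phiFun ha hb _) (continuous_uFun ha hb p).continuousOn
    (fun _ hy => hasDerivAt_uFun a b p hy) (uFun_neg_one hb a p) (uFun_one ha b p) hx

theorem jacobiWeight_mul_jacobiWeight (a b : ℝ) {x : ℝ} (hx : x ∈ Ioo (-1 : ℝ) 1) :
    jacobiWeight (a / 2) (b / 2) x * jacobiWeight (a / 2 - 1) (b / 2 - 1) x =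
      jacobiWeight (a - 1) (b - 1) x := by
  have h1 : 0 < 1 - x := by linarith [hx.2]
  have h2 : 0 < 1 + x := by linarith [hx.1]
  unfold jacobiWeight
  rw [mul_mul_mul_comm, ← Real.rpow_add h1, ← Real.rpow_add h2]
  congr 2 <;> ring

theorem integral_uFun_mul_phiFun (p q : ℝ[X]) :
    ∫ x in (-1 : ℝ)..1, uFun a b p x * phiFun a b q x = jacobiFunctional ha hb (p * q) := by
  rw [jacobiFunctional_apply]
  refine intervalIntegral.integral_congr_Ioo_of_le (by norm_num) fun x hx => ?_
  simp only [uFun, phiFun, eval_mul, ← jacobiWeight_mul_jacobiWeight a b hx]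
  ring

/-- A Wronskian: the derivatives of the common factor (1-x)^(a/2)(1+x)^(b/2) cancel, leaving the
Wronskian of p and q times the full weight. -/
theorem uFun_mul_phiFun_sub (p q : ℝ[X]) {x : ℝ} (hx : x ∈ Ioo (-1 : ℝ) 1) :
    uFun a b p x * phiFun a b (weightedDeriv (a / 2) (b / 2) q) x -
      phiFun a b (weightedDeriv (a / 2) (b / 2) p) x * uFun a b q x =
    (p * derivative q - q * derivative p).eval x * jacobiWeight a b x := by
  rw [jacobiWeight_eq_mul a b hx, ← jacobiWeight_mul_jacobiWeight a b hx]
  simp only [uFun, phiFun, weightedDeriv_apply, eval_add, eval_mul, eval_sub, eval_one, eval_pow,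
    eval_X, eval_C]
  ring

end HalfWeights

/-! ### Integration by parts against f'. -/

section IntegrationByParts

theorem integrableOn_ofReal_mul {g : ℝ → ℝ} (hg : IntervalIntegrable g volume (-1) 1) {f : ℝ → 𝕜}
    (hf : ContinuousOn f (Icc (-1) 1)) :
    IntegrableOn (fun x => (g x : 𝕜) * f x) (Icc (-1) 1) :=
  IntegrableOn.mul_continuousOn (intervalIntegrable_iff_Icc.1 hg).ofReal hf isCompact_Icc

theorem _root_.ContinuousOn.rclike_ofReal {h : ℝ → ℝ} {s : Set ℝ} (hh : ContinuousOn h s) :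
    ContinuousOn (fun x => (h x : 𝕜)) s :=
  RCLike.continuous_ofReal.comp_continuousOn hh

theorem _root_.HasDerivAt.rclike_ofReal {h : ℝ → ℝ} {h' x : ℝ} (hh : HasDerivAt h h' x) :
    HasDerivAt (fun x => (h x : 𝕜)) (h' : 𝕜) x :=
  (RCLike.ofRealCLM (K := 𝕜)).hasFDerivAt.comp_hasDerivAt x hh

variable {f : ℝ → 𝕜} (hf : ContDiffOn ℝ 1 f (Icc (-1) 1))

include hf in
theorem hasDerivAt_derivWithin_Icc {x : ℝ} (hx : x ∈ Ioo (-1 : ℝ) 1) :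
    HasDerivAt f (derivWithin f (Icc (-1) 1) x) x :=
  ((hf.differentiableOn one_ne_zero x (Ioo_subset_Icc_self hx)).hasDerivWithinAt).hasDerivAt
    (Icc_mem_nhds hx.1 hx.2)

include hf in
theorem continuousOn_derivWithin_Icc : ContinuousOn (derivWithin f (Icc (-1) 1)) (Icc (-1) 1) :=
  hf.continuousOn_derivWithin (uniqueDiffOn_Icc (by norm_num)) le_rfl

include hf in
-- The boundary terms vanish through g. Derivatives of h and g are needed only inside the interval,
-- because the functions φ_k may be singular at ±1.
theorem integral_mul_derivWithin {h g h' g' : ℝ → ℝ} (hh : ContinuousOn h (Icc (-1) 1))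
    (hg : ContinuousOn g (Icc (-1) 1)) (hh' : IntervalIntegrable h' volume (-1) 1)
    (hg' : IntervalIntegrable g' volume (-1) 1)
    (hdh : ∀ x ∈ Ioo (-1 : ℝ) 1, HasDerivAt h (h' x) x)
    (hdg : ∀ x ∈ Ioo (-1 : ℝ) 1, HasDerivAt g (g' x) x) (h0 : g (-1) = 0) (h1 : g 1 = 0) :
    ∫ x in Icc (-1 : ℝ) 1, (h x : 𝕜) * derivWithin f (Icc (-1) 1) x * g x =
      -∫ x in Icc (-1 : ℝ) 1, ((h' x * g x + h x * g' x : ℝ) : 𝕜) * f x := by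
  have hI1 : IntegrableOn (fun x => (h x : 𝕜) * derivWithin f (Icc (-1) 1) x * g x)
      (Icc (-1 : ℝ) 1) :=
    ((hh.rclike_ofReal.mul (continuousOn_derivWithin_Icc hf)).mul
      hg.rclike_ofReal).integrableOn_compact isCompact_Icc
  have hreal : IntervalIntegrable (fun x => h' x * g x + h x * g' x) volume (-1) 1 := by
    refine (hh'.mul_continuousOn ?_).add (hg'.continuousOn_mul ?_) <;>
      rwa [uIcc_of_le (by norm_num)]
  have hI2 := integrableOn_ofReal_mul (𝕜 := 𝕜) hreal hf.continuousOn
  have hI : IntegrableOn (fun x => (h x : 𝕜) * derivWithin f (Icc (-1) 1) x * g x +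
      ((h' x * g x + h x * g' x : ℝ) : 𝕜) * f x) (Icc (-1 : ℝ) 1) := hI1.add hI2
  rw [eq_neg_iff_add_eq_zero, ← integral_add hI1 hI2, setIntegral_Icc_eq]
  rw [intervalIntegral.integral_eq_sub_of_hasDerivAt_of_le (f := fun x => (h x : 𝕜) * f x * g x)
    (by norm_num) ((hh.rclike_ofReal.mul hf.continuousOn).mul hg.rclike_ofReal)
    (fun x hx => ?_) (intervalIntegrable_iff_Icc.2 hI)]
  · simp [h0, h1]
  · refine (((hdh x hx).rclike_ofReal.mul (hasDerivAt_derivWithin_Icc hf hx)).mul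
      (hdg x hx).rclike_ofReal).congr_deriv ?_
    push_cast
    simp only [Pi.mul_apply]
    ring

end IntegrationByParts

/-! ### The kernel as a sum of products. -/

section Kernel

open Polynomial

theorem sum_range_two_mul_eq {M : Type*} [AddCommMonoid M] (N : ℕ) (g : ℕ → M) :
    ∑ j ∈ Finset.range (2 * N), g j = ∑ k : Fin N × Fin 2, g (finProdFinEquiv k : ℕ) := by
  rw [mul_comm, ← Fin.sum_univ_eq_sum_range]
  exact (finProdFinEquiv.sum_comp fun i : Fin (N * 2) => g (i : ℕ)).symm

/-- `φ f + (1/2) (ε φ) f'` for `φ = phiFun a b p`. -/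
def vFun (a b : ℝ) (f : ℝ → 𝕜) (p : ℝ[X]) (y : ℝ) : 𝕜 :=
  (phiFun a b p y : 𝕜) * f y +
    1 / 2 * ((eps (phiFun a b p) y : 𝕜) * derivWithin f (Icc (-1) 1) y)

variable {a b : ℝ} (ha : 0 < a) (hb : 0 < b)

include ha hb in
theorem kernelComp_kernelS4_epsKernel (N : ℕ) (x y : ℝ) :
    kernelComp (kernelS4 a b N) epsKernel x y =
      -∑ j ∈ Finset.range (2 * N + 1), (1 - x ^ 2) * phi4 a b j x * eps (phi4 a b j) y := by
  unfold kernelComp kernelS4 eps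
  simp_rw [Finset.sum_mul, ← intervalIntegral.integral_const_mul]
  rw [← intervalIntegral.integral_finsetSum, ← intervalIntegral.integral_neg]
  · congr 1
    ext z
    rw [← Finset.sum_neg_distrib]
    refine Finset.sum_congr rfl fun j _ => ?_
    rw [epsKernel_swap]
    ring
  · intro j _
    rw [phi4_eq_phiFun]
    exact (intervalIntegrable_epsKernel_mul (intervalIntegrable_phiFun ha hb _) y).const_mul _

include ha hb in
-- The antisymmetry of ε turns -½ Sεf' into +½ ∑ u_j ⊗ (εφ_j) f', so the f and f' parts combine into
-- the same v_j throughout, including the two terms with C.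
theorem kernelTJSE_eq_sum (N : ℕ) (f : ℝ → 𝕜) (x y : ℝ) :
    kernelTJSE a b N f x y =
      ∑ j ∈ Finset.range (2 * N + 1), (((1 - x ^ 2) * phi4 a b j x : ℝ) : 𝕜) *
          vFun a b f (orthoJacobi a b j) y +
        ((constC4 a b N * eps (phi4 a b (2 * N + 1)) x : ℝ) : 𝕜) *
          vFun a b f (orthoJacobi a b (2 * N)) y := by
  unfold kernelTJSE vFun
  rw [kernelComp_kernelS4_epsKernel ha hb]
  simp only [kernelS4, ← phi4_eq_phiFun, mul_add, Finset.sum_add_distrib]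
  push_cast
  rw [Finset.sum_mul]
  have h : ∑ j ∈ Finset.range (2 * N + 1), (1 - (x : 𝕜) ^ 2) * (phi4 a b j x : 𝕜) *
      (1 / 2 * ((eps (phi4 a b j) y : 𝕜) * derivWithin f (Icc (-1) 1) y)) =
      (∑ j ∈ Finset.range (2 * N + 1), (1 - (x : 𝕜) ^ 2) * (phi4 a b j x : 𝕜) *
        (eps (phi4 a b j) y : 𝕜)) * (1 / 2 * derivWithin f (Icc (-1) 1) y) := by
    rw [Finset.sum_mul]
    refine Finset.sum_congr rfl fun j _ => ?_
    ring
  simp only [mul_assoc] at h ⊢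
  rw [h]
  ring

include ha hb in
theorem integrableOn_vFun_mul {f : ℝ → 𝕜} (hf : ContDiffOn ℝ 1 f (Icc (-1) 1)) (p q : ℝ[X]) :
    IntegrableOn (fun x => vFun a b f p x * (uFun a b q x : 𝕜)) (Icc (-1) 1) := by
  refine IntegrableOn.mul_continuousOn (Integrable.add ?_ ?_)
    (continuous_uFun ha hb q).continuousOn.rclike_ofReal isCompact_Icc
  · exact integrableOn_ofReal_mul (intervalIntegrable_phiFun ha hb p) hf.continuousOn
  · exact (((continuousOn_eps (intervalIntegrable_phiFun ha hb p)).rclike_ofReal.mul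
      (continuousOn_derivWithin_Icc hf)).integrableOn_compact isCompact_Icc).const_mul _

include ha hb in
theorem intervalIntegrable_phiFun_mul_sub (p q : ℝ[X]) :
    IntervalIntegrable (fun x => phiFun a b p x * uFun a b q x -
      eps (phiFun a b p) x * phiFun a b (weightedDeriv (a / 2) (b / 2) q) x) volume (-1) 1 := by
  refine ((intervalIntegrable_phiFun ha hb _).mul_continuousOn
    (continuous_uFun ha hb q).continuousOn).sub
    ((intervalIntegrable_phiFun ha hb _).continuousOn_mul ?_)
  rw [uIcc_of_le (by norm_num)]
  exact continuousOn_eps (intervalIntegrable_phiFun ha hb p)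

include ha hb in
theorem integral_vFun_mul {f : ℝ → 𝕜} (hf : ContDiffOn ℝ 1 f (Icc (-1) 1)) (p q : ℝ[X]) :
    ∫ x in Icc (-1 : ℝ) 1, vFun a b f p x * (uFun a b q x : 𝕜) =
      1 / 2 * ∫ x in Icc (-1 : ℝ) 1, ((phiFun a b p x * uFun a b q x -
        eps (phiFun a b p) x * phiFun a b (weightedDeriv (a / 2) (b / 2) q) x : ℝ) : 𝕜) * f x := by
  have hφ := intervalIntegrable_phiFun ha hb p
  have hL := intervalIntegrable_phiFun ha hb (weightedDeriv (a / 2) (b / 2) q)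
  have hε := continuousOn_eps hφ
  have hu := (continuous_uFun ha hb q).continuousOn (s := Icc (-1 : ℝ) 1)
  have hparts := integral_mul_derivWithin hf hε hu hφ hL
    (fun x hx => hasDerivAt_eps hφ (continuousOn_phiFun a b p) hx)
    (fun x hx => hasDerivAt_uFun a b q hx) (uFun_neg_one hb a q) (uFun_one ha b q)
  have hA : IntervalIntegrable (fun x => phiFun a b p x * uFun a b q x) volume (-1) 1 :=
    hφ.mul_continuousOn (by rwa [uIcc_of_le (by norm_num)])
  have hB : IntervalIntegrable (fun x => eps (phiFun a b p) x *
      phiFun a b (weightedDeriv (a / 2) (b / 2) q) x) volume (-1) 1 :=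
    hL.continuousOn_mul (by rwa [uIcc_of_le (by norm_num)])
  have hA' := integrableOn_ofReal_mul (𝕜 := 𝕜) hA hf.continuousOn
  have hB' := integrableOn_ofReal_mul (𝕜 := 𝕜) hB hf.continuousOn
  have hD : IntegrableOn (fun x => (eps (phiFun a b p) x : 𝕜) * derivWithin f (Icc (-1) 1) x *
      (uFun a b q x : 𝕜)) (Icc (-1) 1) :=
    ((hε.rclike_ofReal.mul (continuousOn_derivWithin_Icc hf)).mul
      hu.rclike_ofReal).integrableOn_compact isCompact_Icc
  have e1 : ∀ x, vFun a b f p x * (uFun a b q x : 𝕜) =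
      ((phiFun a b p x * uFun a b q x : ℝ) : 𝕜) * f x + 1 / 2 * ((eps (phiFun a b p) x : 𝕜) *
        derivWithin f (Icc (-1) 1) x * (uFun a b q x : 𝕜)) := by
    intro x
    simp only [vFun]
    push_cast
    ring
  have e2 : ∀ x, ((phiFun a b p x * uFun a b q x + eps (phiFun a b p) x *
      phiFun a b (weightedDeriv (a / 2) (b / 2) q) x : ℝ) : 𝕜) * f x =
      ((phiFun a b p x * uFun a b q x : ℝ) : 𝕜) * f x + ((eps (phiFun a b p) x *
      phiFun a b (weightedDeriv (a / 2) (b / 2) q) x : ℝ) : 𝕜) * f x := by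
    intro x
    push_cast
    ring
  have e3 : ∀ x, ((phiFun a b p x * uFun a b q x - eps (phiFun a b p) x *
      phiFun a b (weightedDeriv (a / 2) (b / 2) q) x : ℝ) : 𝕜) * f x =
      ((phiFun a b p x * uFun a b q x : ℝ) : 𝕜) * f x - ((eps (phiFun a b p) x *
      phiFun a b (weightedDeriv (a / 2) (b / 2) q) x : ℝ) : 𝕜) * f x := by
    intro x
    push_cast
    ring
  simp_rw [e2] at hparts
  simp_rw [e1, e3]
  rw [integral_add hA' hB'] at hparts
  rw [integral_add hA' (hD.const_mul _), integral_sub hA' hB', integral_const_mul, hparts]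
  ring

/-- After f' is removed by parts, the sum over j replaces φ_j by u_m' and εφ_j by u_m. The bound m +
1 < n ensures that row m of D is complete. -/
theorem sum_derivMatrix_mul_integral {f : ℝ → 𝕜} (hf : ContDiffOn ℝ 1 f (Icc (-1) 1)) {m n : ℕ}
    (hm : m + 1 < n) (q : ℝ[X]) :
    ∑ j ∈ Finset.range n, (derivMatrix ha hb m j : 𝕜) *
        ∫ x in Icc (-1 : ℝ) 1, vFun a b f (orthoJacobi a b j) x * (uFun a b q x : 𝕜) =
      -(1 / 2) * ∫ x in Icc (-1 : ℝ) 1, ((uFun a b (orthoJacobi a b m) x *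
        phiFun a b (weightedDeriv (a / 2) (b / 2) q) x -
        phiFun a b (weightedDeriv (a / 2) (b / 2) (orthoJacobi a b m)) x * uFun a b q x : ℝ) : 𝕜) *
          f x := by
  simp_rw [integral_vFun_mul ha hb hf, mul_left_comm _ (1 / 2 : 𝕜), ← integral_const_mul]
  rw [← integral_finsetSum]
  · refine setIntegral_congr_fun measurableSet_Icc fun x hx => ?_
    have h1 : phiFun a b (weightedDeriv (a / 2) (b / 2) (orthoJacobi a b m)) =
        fun x => ∑ j ∈ Finset.range n, derivMatrix ha hb m j * phiFun a b (orthoJacobi a b j) x := by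
      rw [← phiFun_sum_smul, ← weightedDeriv_orthoJacobi ha hb hm]
    have h2 := eps_phiFun_weightedDeriv ha hb (orthoJacobi a b m) hx
    rw [h1, eps_sum_mul _ _ _ fun j _ => intervalIntegrable_phiFun ha hb _] at h2
    simp only [h1, ← h2, Finset.sum_mul]
    rw [← Finset.sum_sub_distrib]
    push_cast
    rw [Finset.sum_mul, Finset.mul_sum]
    refine Finset.sum_congr rfl fun j _ => ?_
    ring
  · intro j _
    exact ((integrableOn_ofReal_mul (intervalIntegrable_phiFun_mul_sub ha hb _ _)
      hf.continuousOn).const_mul _).const_mul _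

end Kernel

/-! ### The antisymmetrized moment matrix and G². -/

section Gram

open Polynomial Matrix

variable {a b : ℝ} (ha : 0 < a) (hb : 0 < b)

/-- The matrix `∫ p_k p_l' w (1 + f)` for the orthonormal Jacobi polynomials `p_k`. -/
def gramMatrix (a b : ℝ) (N : ℕ) (f : ℝ → 𝕜) : Matrix (Fin N × Fin 2) (Fin N × Fin 2) 𝕜 :=
  Matrix.of fun k l => ∫ x in Icc (-1 : ℝ) 1,
    (((orthoJacobi a b (finProdFinEquiv k : ℕ) *
      derivative (orthoJacobi a b (finProdFinEquiv l : ℕ))).eval x : ℝ) : 𝕜) *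
      ((jacobiWeight a b x : 𝕜) * (1 + f x))

/-- The first `2N` rows and columns of `derivMatrix`. -/
def derivMatrixTrunc (N : ℕ) : Matrix (Fin N × Fin 2) (Fin N × Fin 2) ℝ :=
  Matrix.of fun k l => derivMatrix ha hb (finProdFinEquiv k : ℕ) (finProdFinEquiv l : ℕ)

include ha hb in
theorem integrableOn_eval_mul_weight {f : ℝ → 𝕜} (hf : ContinuousOn f (Icc (-1) 1)) (p : ℝ[X]) :
    IntegrableOn (fun x => ((p.eval x : ℝ) : 𝕜) * ((jacobiWeight a b x : 𝕜) * (1 + f x)))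
      (Icc (-1) 1) :=
  (p.continuousOn.rclike_ofReal.mul
    ((continuous_jacobiWeight ha.le hb.le).continuousOn.rclike_ofReal.mul
      (continuousOn_const.add hf))).integrableOn_compact isCompact_Icc

/-- The integrand is the Wronskian of p_k and p_l times w(1+f), that is (u_k u_l' - u_k' u_l)(1+f).
The summand 1 integrates to D_lk - D_kl = -2D_kl. -/
theorem gramMatrix_sub_transpose (N : ℕ) {f : ℝ → 𝕜} (hf : ContinuousOn f (Icc (-1) 1)) :
    gramMatrix a b N f - (gramMatrix a b N f)ᵀ = Matrix.of fun k l =>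
      (-2 * (derivMatrixTrunc ha hb N k l : 𝕜)) +
        ∫ x in Icc (-1 : ℝ) 1, ((uFun a b (orthoJacobi a b (finProdFinEquiv k : ℕ)) x *
          phiFun a b (weightedDeriv (a / 2) (b / 2) (orthoJacobi a b (finProdFinEquiv l : ℕ))) x -
          phiFun a b (weightedDeriv (a / 2) (b / 2) (orthoJacobi a b (finProdFinEquiv k : ℕ))) x *
            uFun a b (orthoJacobi a b (finProdFinEquiv l : ℕ)) x : ℝ) : 𝕜) * f x := by
  ext k l
  simp only [Matrix.sub_apply, Matrix.transpose_apply, gramMatrix, Matrix.of_apply,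
    derivMatrixTrunc]
  rw [← integral_sub (integrableOn_eval_mul_weight ha hb hf _)
    (integrableOn_eval_mul_weight ha hb hf _)]
  generalize (finProdFinEquiv k : ℕ) = i
  generalize (finProdFinEquiv l : ℕ) = j
  set p := orthoJacobi a b i with hp
  set q := orthoJacobi a b j with hq
  have hu : ∀ r, ContinuousOn (uFun a b r) (uIcc (-1) 1) := fun r =>
    (continuous_uFun ha hb r).continuousOn
  have hI1 : IntervalIntegrable (fun x => uFun a b p x *
      phiFun a b (weightedDeriv (a / 2) (b / 2) q) x) volume (-1) 1 :=
    (intervalIntegrable_phiFun ha hb _).continuousOn_mul (hu p)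
  have hI2 : IntervalIntegrable (fun x => phiFun a b (weightedDeriv (a / 2) (b / 2) p) x *
      uFun a b q x) volume (-1) 1 :=
    (intervalIntegrable_phiFun ha hb _).mul_continuousOn (hu q)
  have hreal : ∫ x in Icc (-1 : ℝ) 1, ((uFun a b p x *
      phiFun a b (weightedDeriv (a / 2) (b / 2) q) x -
      phiFun a b (weightedDeriv (a / 2) (b / 2) p) x * uFun a b q x : ℝ) : 𝕜) =
      -2 * (derivMatrix ha hb i j : 𝕜) := by
    rw [integral_ofReal, setIntegral_Icc_eq, intervalIntegral.integral_sub hI1 hI2]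
    simp_rw [mul_comm (phiFun _ _ _ _)]
    rw [integral_uFun_mul_phiFun ha hb, integral_uFun_mul_phiFun ha hb, mul_comm p, mul_comm q]
    change ((derivMatrix ha hb j i - derivMatrix ha hb i j : ℝ) : 𝕜) = _
    rw [derivMatrix_antisymm]
    push_cast
    ring
  rw [← hreal, ← integral_add]
  · rw [integral_Icc_eq_integral_Ioo, integral_Icc_eq_integral_Ioo]
    refine setIntegral_congr_fun measurableSet_Ioo fun x hx => ?_
    rw [uFun_mul_phiFun_sub p q hx, eval_sub]
    push_cast
    ring
  · exact (intervalIntegrable_iff_Icc.1 (hI1.sub hI2)).ofReal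
  · exact integrableOn_ofReal_mul (hI1.sub hI2) hf

theorem exists_mul_integral_eq_pairSum {a b : ℝ} (ha : 0 < a) (hb : 0 < b) (N : ℕ) :
    ∃ c : ℝ, c ≠ 0 ∧ ∀ f : ℝ → 𝕜, ContinuousOn f (Icc (-1) 1) →
      (c : 𝕜) * ∫ x in univ.pi (fun _ : Fin N => Icc (-1 : ℝ) 1),
        ((jointWeight 4 (jacobiWeight a b) x : ℝ) : 𝕜) * ∏ j : Fin N, (1 + f (x j)) =
      pairSum (gramMatrix a b N f) := by
  refine ⟨∏ j : Fin (N * 2), (orthoJacobi a b j).leadingCoeff,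
    Finset.prod_ne_zero_iff.2 fun j _ => leadingCoeff_ne_zero.2 fun h => ?_, fun f hf => ?_⟩
  · have := coeff_orthoJacobi_pos ha hb j
    simp [h] at this
  · have h := integral_vandermonde_pow_four (N := N) (orthoJacobi a b) (natDegree_orthoJacobi ha hb)
      (fun k h => by
        have := coeff_orthoJacobi_pos ha hb k
        simp [h] at this)
      (fun x => (jacobiWeight a b x : 𝕜) * (1 + f x))
      (fun p => integrableOn_eval_mul_weight ha hb hf p)
    rw [gramMatrix, ← h]
    congr 2
    ext x
    simp only [jointWeight, Finset.prod_mul_distrib]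
    push_cast
    ring

theorem pairSum_gramMatrix_zero_ne_zero {a b : ℝ} (ha : 0 < a) (hb : 0 < b) (N : ℕ) :
    pairSum (gramMatrix a b N (0 : ℝ → 𝕜)) ≠ 0 := by
  obtain ⟨c, hc, h⟩ := exists_mul_integral_eq_pairSum (𝕜 := 𝕜) ha hb N
  rw [← h 0 continuousOn_const]
  refine mul_ne_zero (by exact_mod_cast hc) ?_
  simp only [Pi.zero_apply, add_zero, Finset.prod_const_one, mul_one]
  rw [integral_ofReal]
  exact_mod_cast (integral_jointWeight_pos ha.le hb.le N).ne'

theorem mgf_four_eq {a b : ℝ} (ha : 0 < a) (hb : 0 < b) (N : ℕ) {f : ℝ → 𝕜}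
    (hf : ContinuousOn f (Icc (-1) 1)) :
    mgf 4 (jacobiWeight a b) N f = pairSum (gramMatrix a b N f) / pairSum (gramMatrix a b N 0) := by
  obtain ⟨c, hc, h⟩ := exists_mul_integral_eq_pairSum (𝕜 := 𝕜) ha hb N
  have hc' : (c : 𝕜) ≠ 0 := by exact_mod_cast hc
  rw [← h f hf, ← h 0 continuousOn_const, mul_div_mul_left _ _ hc', mgf, ← integral_ofReal]
  simp

theorem gramMatrix_zero_sub_transpose (N : ℕ) :
    gramMatrix a b N (0 : ℝ → 𝕜) - (gramMatrix a b N (0 : ℝ → 𝕜))ᵀ =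
      (-2 : 𝕜) • (derivMatrixTrunc ha hb N).map RCLike.ofReal := by
  rw [gramMatrix_sub_transpose ha hb N (f := 0) continuousOn_const]
  ext k l
  simp

include ha hb in
/-- `G_N(f)²` as a ratio of determinants. -/
theorem mgf_four_sq_mul_det (N : ℕ) {f : ℝ → 𝕜} (hf : ContinuousOn f (Icc (-1) 1)) :
    (gramMatrix a b N (0 : ℝ → 𝕜) - (gramMatrix a b N (0 : ℝ → 𝕜))ᵀ).det ≠ 0 ∧
    mgf 4 (jacobiWeight a b) N f ^ 2 *
      (gramMatrix a b N (0 : ℝ → 𝕜) - (gramMatrix a b N (0 : ℝ → 𝕜))ᵀ).det =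
      (gramMatrix a b N f - (gramMatrix a b N f)ᵀ).det := by
  obtain ⟨c, hc⟩ := exists_pairSum_sq_eq 𝕜 N
  have hskew : ∀ g : ℝ → 𝕜, (gramMatrix a b N g - (gramMatrix a b N g)ᵀ)ᵀ =
      -(gramMatrix a b N g - (gramMatrix a b N g)ᵀ) := by
    intro g
    simp
  have h0 := hc _ (hskew 0)
  have hf' := hc _ (hskew f)
  have hne := pairSum_gramMatrix_zero_ne_zero (𝕜 := 𝕜) ha hb N
  rw [pairSum_sub_transpose] at h0 hf'
  have h2 : (2 : 𝕜) ^ N ≠ 0 := pow_ne_zero _ two_ne_zero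
  have hcd : c * (gramMatrix a b N (0 : ℝ → 𝕜) - (gramMatrix a b N (0 : ℝ → 𝕜))ᵀ).det ≠ 0 := by
    rw [← h0]
    exact pow_ne_zero _ (mul_ne_zero h2 hne)
  refine ⟨right_ne_zero_of_mul hcd, ?_⟩
  rw [mgf_four_eq ha hb N hf, div_pow]
  apply mul_left_cancel₀ (left_ne_zero_of_mul hcd)
  rw [mul_left_comm, ← h0, ← hf']
  field_simp

/-- A vanishing determinant would make the normalization integral zero, contrary to its positivity.
-/
theorem det_derivMatrixTrunc_ne_zero (N : ℕ) : (derivMatrixTrunc ha hb N).det ≠ 0 := by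
  have h := (mgf_four_sq_mul_det (𝕜 := ℝ) ha hb N (f := 0) continuousOn_const).1
  rw [gramMatrix_zero_sub_transpose ha hb, Matrix.det_smul] at h
  exact right_ne_zero_of_mul h

end Gram

/-! ### Reduction to rank at most 2N and comparison of determinants. -/

section Main

open Polynomial Matrix

variable {a b : ℝ} (ha : 0 < a) (hb : 0 < b)

theorem uFun_orthoJacobi_eq_sum {j n : ℕ} (h : j + 1 < n) {x : ℝ} (hx : x ∈ Icc (-1 : ℝ) 1) :
    uFun a b (orthoJacobi a b j) x =
      ∑ k ∈ Finset.range n, derivMatrix ha hb j k * eps (phi4 a b k) x := by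
  rw [← eps_phiFun_weightedDeriv ha hb _ hx, weightedDeriv_orthoJacobi ha hb h, phiFun_sum_smul,
    eps_sum_mul _ _ _ fun j _ => intervalIntegrable_phiFun ha hb _]
  simp_rw [phi4_eq_phiFun]

theorem finProdFinEquiv_lt_two_mul {N : ℕ} (k : Fin N × Fin 2) :
    (finProdFinEquiv k : ℕ) < 2 * N := by
  have := (finProdFinEquiv k).2
  omega

/-- The function `u_{2N} + C_{2N} ε φ_{2N+1}` lies in the span of `u_0, …, u_{2N-1}`. -/
theorem exists_coeff_uFun_two_mul {N : ℕ} (hN : 1 ≤ N) : ∃ α : Fin N × Fin 2 → ℝ,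
    (∀ m, ∑ k, derivMatrixTrunc ha hb N m k * α k =
      derivMatrix ha hb (finProdFinEquiv m : ℕ) (2 * N)) ∧
    ∀ x ∈ Icc (-1 : ℝ) 1, uFun a b (orthoJacobi a b (2 * N)) x +
      constC4 a b N * eps (phi4 a b (2 * N + 1)) x =
      ∑ k : Fin N × Fin 2, α k * uFun a b (orthoJacobi a b (finProdFinEquiv k : ℕ)) x := by
  set D := derivMatrixTrunc ha hb N with hD
  set δ : Fin N × Fin 2 → ℝ := fun m => derivMatrix ha hb (finProdFinEquiv m : ℕ) (2 * N) with hδ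
  have hu : IsUnit D.det := isUnit_iff_ne_zero.2 (det_derivMatrixTrunc_ne_zero ha hb N)
  set α := D⁻¹ *ᵥ δ with hα
  have hDα : D *ᵥ α = δ := by
    rw [hα, Matrix.mulVec_mulVec, Matrix.mul_nonsing_inv _ hu, Matrix.one_mulVec]
  have hDt : Dᵀ = -D := by
    ext k l
    exact derivMatrix_antisymm ha hb _ _
  have hαD : α ᵥ* D = -δ := by
    rw [← Matrix.mulVec_transpose, hDt, Matrix.neg_mulVec, hDα]
  -- This is the quadratic form of the antisymmetric D at α. Its vanishing removes εφ_{2N}, which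
  -- does not occur in row 2N since D has zero diagonal.
  have hαδ : α ⬝ᵥ δ = 0 := by
    have h : α ⬝ᵥ δ = -(α ⬝ᵥ δ) := by
      conv_lhs => rw [← hDα, Matrix.dotProduct_mulVec, hαD, neg_dotProduct, dotProduct_comm]
    linarith
  refine ⟨α, fun m => congrFun hDα m, fun x hx => ?_⟩
  have h1 : ∀ k : Fin N × Fin 2, uFun a b (orthoJacobi a b (finProdFinEquiv k : ℕ)) x =
      (∑ l : Fin N × Fin 2, D k l * eps (phi4 a b (finProdFinEquiv l : ℕ)) x) +
        δ k * eps (phi4 a b (2 * N)) x := by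
    intro k
    rw [uFun_orthoJacobi_eq_sum ha hb (n := 2 * N + 1) (by
      have := finProdFinEquiv_lt_two_mul k; omega) hx, Finset.sum_range_succ,
      sum_range_two_mul_eq]
    rfl
  have h2 : uFun a b (orthoJacobi a b (2 * N)) x =
      (∑ l : Fin N × Fin 2, -δ l * eps (phi4 a b (finProdFinEquiv l : ℕ)) x) -
        constC4 a b N * eps (phi4 a b (2 * N + 1)) x := by
    rw [uFun_orthoJacobi_eq_sum ha hb (n := 2 * N + 2) (by omega) hx, Finset.sum_range_succ,
      Finset.sum_range_succ, sum_range_two_mul_eq, derivMatrix_self, derivMatrix_two_mul ha hb hN]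
    simp_rw [derivMatrix_antisymm ha hb (2 * N)]
    ring
  have h3 : ∑ k : Fin N × Fin 2, α k * uFun a b (orthoJacobi a b (finProdFinEquiv k : ℕ)) x =
      ∑ l : Fin N × Fin 2, (α ᵥ* D) l * eps (phi4 a b (finProdFinEquiv l : ℕ)) x +
        (α ⬝ᵥ δ) * eps (phi4 a b (2 * N)) x := by
    simp_rw [h1, mul_add, Finset.sum_add_distrib, Finset.mul_sum]
    rw [Finset.sum_comm]
    simp only [Matrix.vecMul, dotProduct, Finset.sum_mul, mul_assoc]
  rw [h3, h2, hαD, hαδ]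
  simp

end Main

end JacobiSymplectic

end

open JacobiSymplectic in
theorem mainTheorem1 {𝕜 : Type*} [RCLike 𝕜] (a b : ℝ) (ha : 0 < a) (hb : 0 < b)
    (N : ℕ) (hN : 1 ≤ N) (f : ℝ → 𝕜) (hf : ContDiffOn ℝ 1 f (Set.Icc (-1) 1))
    (hf_left : f (-1) = 0) (hf_right : f 1 = 0) :
    FredholmDetExists (Set.Icc (-1) 1) (kernelTJSE a b N f) ∧
      mgf 4 (jacobiWeight a b) N f ^ 2 =
        fredholmDet (Set.Icc (-1) 1) (kernelTJSE a b N f) := by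
  obtain ⟨α, hα, hspan⟩ := exists_coeff_uFun_two_mul ha hb hN
  set u : Fin N × Fin 2 → ℝ → 𝕜 := fun k x =>
    (uFun a b (orthoJacobi a b (finProdFinEquiv k : ℕ)) x : 𝕜) with hu
  set V : Fin N × Fin 2 → ℝ → 𝕜 := fun k y =>
    vFun a b f (orthoJacobi a b (finProdFinEquiv k : ℕ)) y +
      (α k : 𝕜) * vFun a b f (orthoJacobi a b (2 * N)) y with hV
  have hT : ∀ x ∈ Set.Icc (-1 : ℝ) 1, ∀ y ∈ Set.Icc (-1 : ℝ) 1,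
      kernelTJSE a b N f x y = ∑ k, u k x * V k y := by
    intro x hx y _
    have hx' : ∀ j, (1 - x ^ 2) * phi4 a b j x = uFun a b (orthoJacobi a b j) x := fun j => by
      rw [phi4_eq_phiFun, one_sub_sq_mul_phiFun ha hb _ hx]
    rw [kernelTJSE_eq_sum ha hb, Finset.sum_range_succ]
    simp_rw [hx']
    rw [sum_range_two_mul_eq, add_assoc, ← add_mul, ← RCLike.ofReal_add, hspan x hx]
    simp only [hu, hV, mul_add, Finset.sum_add_distrib]
    push_cast
    rw [Finset.sum_mul]
    congr 1
    refine Finset.sum_congr rfl fun k _ => ?_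
    ring
  have hterm : ∀ k l, IntegrableOn (fun x => (α k : 𝕜) * (vFun a b f (orthoJacobi a b (2 * N)) x *
      u l x)) (Set.Icc (-1) 1) := fun k l =>
    (integrableOn_vFun_mul ha hb hf _ _).const_mul _
  have hVu : ∀ k l, (fun x => V k x * u l x) = fun x =>
      vFun a b f (orthoJacobi a b (finProdFinEquiv k : ℕ)) x * u l x +
        (α k : 𝕜) * (vFun a b f (orthoJacobi a b (2 * N)) x * u l x) := by
    intro k l
    ext x
    simp only [hV]
    ring
  have hint : ∀ k l, IntegrableOn (fun x => V k x * u l x) (Set.Icc (-1) 1) := by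
    intro k l
    rw [hVu]
    exact (integrableOn_vFun_mul ha hb hf _ _).add (hterm k l)
  obtain ⟨hex, hdet⟩ := fredholmDet_finiteRank _ u V hT measurableSet_Icc hint
  refine ⟨hex, ?_⟩
  obtain ⟨hne, hratio⟩ := mgf_four_sq_mul_det (𝕜 := 𝕜) ha hb N hf.continuousOn
  rw [hdet]
  -- Both sides are multiplied by det(-2D) ≠ 0, so the claim follows from the matrix identity -2D(1
  -- + R) = A_f - A_fᵀ.
  apply mul_right_cancel₀ hne
  rw [hratio, mul_comm, ← Matrix.det_mul, gramMatrix_zero_sub_transpose ha hb,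
    gramMatrix_sub_transpose ha hb N hf.continuousOn]
  congr 1
  ext m l
  rw [mul_add, mul_one, Matrix.add_apply, Matrix.smul_mul, Matrix.smul_apply, Matrix.smul_apply,
    Matrix.of_apply]
  congr 1
  have hsum := sum_derivMatrix_mul_integral (𝕜 := 𝕜) ha hb hf
    (m := (finProdFinEquiv m : ℕ)) (n := 2 * N + 1)
    (by have := finProdFinEquiv_lt_two_mul m; omega) (orthoJacobi a b (finProdFinEquiv l : ℕ))
  -- The α-terms contribute (Dα)_m = D_{m,2N}, which restores the column j = 2N lost by truncation.
  have hR : ((derivMatrixTrunc ha hb N).map (RCLike.ofReal : ℝ → 𝕜) * Matrix.of fun k l =>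
      ∫ x in Set.Icc (-1 : ℝ) 1, V k x * u l x) m l =
      ∑ j ∈ Finset.range (2 * N + 1), (derivMatrix ha hb (finProdFinEquiv m : ℕ) j : 𝕜) *
        ∫ x in Set.Icc (-1 : ℝ) 1, vFun a b f (orthoJacobi a b j) x * u l x := by
    rw [Matrix.mul_apply, Finset.sum_range_succ, sum_range_two_mul_eq, ← hα m]
    push_cast
    rw [Finset.sum_mul, ← Finset.sum_add_distrib]
    refine Finset.sum_congr rfl fun k _ => ?_
    rw [Matrix.of_apply, hVu, integral_add (integrableOn_vFun_mul ha hb hf _ _) (hterm k l),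
      integral_const_mul, Matrix.map_apply]
    simp only [derivMatrixTrunc, Matrix.of_apply]
    ring
  rw [hR, hsum, smul_eq_mul]
  ring
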